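/- Setting. Let $P$ be the discrete-time LTI plant $$x_{t+1}=Ax_t+B_dd_t+B_uu_t,\qquad e_t=C_ex_t+D_{eu}u_t,\qquad y_t=C_yx_t+D_{yd}d_t ,$$ with real matrices, and put $Q=C_e^\top C_e$, $S=C_e^\top D_{eu}$, $R=D_{eu}^\top D_{eu}$. Assume: (i) $R\succ0$; (ii) $(A,B_u)$ is stabilizable; (iii) $A-B_uR^{-1}S^\top$ is nonsingular; (iv) $\begin{bmatrix}A-e^{j\theta}I&B_u\\ C_e&D_{eu}\end{bmatrix}$ has full column rank for all $\theta\in[0,2\pi]$. Let $X\succeq0$ be the stabilizing solution of the Riccati equation $$0=X-A^\top XA-Q+(A^\top XB_u+S)(R+B_u^\top XB_u)^{-1}(A^\top XB_u+S)^\top ,$$ i.e. with $H=R+B_u^\top XB_u$ and $K_x=H^{-1}(A^\top XB_u+S)^\top$ the matrix $A-B_uK_x$ is Schur (spectral radius $<1$). Put $K_v=H^{-1}B_u^\top$, $K_d=H^{-1}B_u^\top XB_d$. The optimal non-causal controller $K^o$ is $$v_t=(A-B_uK_x)^\top(v_{t+1}+XB_dd_t),\quad v_\infty=0,\qquad u_t=-K_xx_t-K_vv_{t+1}-K_dd_t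 .$$ Signals are two-sided sequences, $\ell_2$ is the space of those with $\|w\|_2^2=\sum_{t\in\mathbb Z}w_t^\top w_t<\infty$, and $x_{-\infty}=0$. A controller $K$ is a finite-dimensional causal LTI state-space system, of any order, from $y$ to $u$; $F_L(P,K)$ is the closed loop from $d$ to $e$. A system is called stable if its state matrix is Schur (for $F_L(P,K)$ the state is the state of $P$ together with that of $K$). For $K$ with $F_L(P,K)$ stable, and for $K^o$, the cost is $J(\cdot,d)=\|e\|_2^2$. For a stable system, $\|G\|_\infty=\max_{\theta\in[0,2\pi]}\bar\sigma(G(e^{j\theta}))$. Let $\gamma_d,\gamma_J\ge0$. We say that $K$ achieves $(\gamma_d,\gamma_J)$-regret relative to $K^o$ if $F_L(P,K)$ is stable and the bound $J(K,d)<\gamma_d^2\|d\|_2^2+\gamma_J^2J(K^o,d)$ holds uniformly over $d\neq0$, i.e. for some $\varepsilon>0$ $$J(K,d)+\varepsilon\|d\|_2^2\le\gamma_d^2\|d\|_2^2+\gamma_J^2J(K^o,d)\qquad\text{for all }d\in\ell_2 ,$$ and that $K$ achieves it pointwise if $F_L(P,K)$ is stable and $J(K,d)<\gamma_d^2\|d\|_2^2+\gamma_J^2J(K^o,d)$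 for every $0\ne d\in\ell_2$. Let $F$ be a spectral factor of the benchmark cost: a stable, causal, square LTI state-space system with invertible feedthrough matrix and stable (causal) inverse $F^{-1}$ (the standard state-space inverse) such that $\|Fd\|_2^2=\gamma_d^2\|d\|_2^2+\gamma_J^2J(K^o,d)$ for all $d\in\ell_2$. Theorem. For every controller $K$: 1. $K$ achieves $(\gamma_d,\gamma_J)$-regret relative to $K^o$ if and only if $F_L(P,K)F^{-1}$ is stable and $\|F_L(P,K)F^{-1}\|_\infty<1$. 2. If $F_L(P,K)F^{-1}$ is stable and $\|F_L(P,K)F^{-1}\|_\infty<1$, then $K$ achieves $(\gamma_d,\gamma_J)$-regret pointwise; if $K$ achieves it pointwise, then $F_L(P,K)F^{-1}$ is stable and $\|F_L(P,K)F^{-1}\|_\infty\le1$. 3. Let $P_F$ be the weighted plant obtained from $P$ by substituting $d=F^{-1}\hat d$. Then $K$ achieves $(\gamma_d,\gamma_J)$-regret if and only if $F_L(P_F,K)$ is stable and $\|F_L(P_F,K)\|_\infty<1$. Hence some controller achieves $(\gamma_d,\gamma_J)$-regret if and only if the standard $H_\infty$ problem for $P_F$ with level $1$ is feasible. 4. Special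 cases. For $\gamma>0$, $K$ achieves $(\gamma,0)$-regret if and only if $F_L(P,K)$ is stable and $\|F_L(P,K)\|_\infty<\gamma$. For $\gamma\ge0$, $K$ achieves $(\gamma,1)$-regret if and only if $F_L(P,K)$ is stable and for some $\varepsilon>0$ one has $J(K,d)-J(K^o,d)\le(\gamma^2-\varepsilon)\|d\|_2^2$ for all $d\in\ell_2$ (additive regret $\gamma$). If $\gamma_d=0$, then $K$ achieves $(0,\gamma_J)$-regret if and only if $F_L(P,K)$ is stable and for some $\rho<\gamma_J^2$ one has $J(K^o,d)>0$ and $J(K,d)/J(K^o,d)\le\rho$ for all $0\ne d\in\ell_2$ (competitive ratio $\gamma_J$). -/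

import Mathlib

open Matrix Filter Topology

noncomputable section

/-- A finite-dimensional discrete-time LTI system
`x (t+1) = A x t + B d t`, `e t = C x t + D d t`,
with state, input and output coordinates indexed by `n`, `m`, `p`. -/
structure LTISystem (n m p : Type*) where
  A : Matrix n n ℝ
  B : Matrix n m ℝ
  C : Matrix p n ℝ
  D : Matrix p m ℝ

/-- A generalized plant
`x (t+1) = A x t + Bd d t + Bu u t`, `e t = Ce x t + Deu u t`, `y t = Cy x t + Dyd d t`
(no feedthrough from `d` to `e` or from `u` to `y`). -/
structure Plant (nx nd nu ne ny : Type*) where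
  A : Matrix nx nx ℝ
  Bd : Matrix nx nd ℝ
  Bu : Matrix nx nu ℝ
  Ce : Matrix ne nx ℝ
  Deu : Matrix ne nu ℝ
  Cy : Matrix ny nx ℝ
  Dyd : Matrix ny nd ℝ

/-- A real square matrix is Schur if its (complex) spectral radius is `< 1`. -/
def IsSchur {n : Type*} [Fintype n] [DecidableEq n] (A : Matrix n n ℝ) : Prop :=
  spectralRadius ℂ (A.map (fun a : ℝ => (a : ℂ))) < 1

section Signals

/-- Membership of a two-sided vector sequence in `ℓ₂`. -/
def IsL2 {ι : Type*} [Fintype ι] (w : ℤ → ι → ℝ) : Prop :=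
  Summable fun t => w t ⬝ᵥ w t

/-- `‖w‖₂² = ∑ₜ wₜᵀ wₜ`. -/
def energy {ι : Type*} [Fintype ι] (w : ℤ → ι → ℝ) : ℝ :=
  ∑' t, w t ⬝ᵥ w t

/-- For Schur `A`: the solution of `x (t+1) = A x t + w t` with `x (-∞) = 0`. -/
def forwardSol {n : Type*} [Fintype n] [DecidableEq n] (A : Matrix n n ℝ)
    (w : ℤ → n → ℝ) (t : ℤ) : n → ℝ :=
  ∑' k : ℕ, (A ^ k) *ᵥ w (t - 1 - k)

/-- For Schur `A`: the solution of `v t = A v (t+1) + w t` with `v (+∞) = 0`. -/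
def backwardSol {n : Type*} [Fintype n] [DecidableEq n] (A : Matrix n n ℝ)
    (w : ℤ → n → ℝ) (t : ℤ) : n → ℝ :=
  ∑' k : ℕ, (A ^ k) *ᵥ w (t + k)

/-! Well-definedness of the signals above. -/

open scoped Matrix.Norms.Operator in
theorem IsSchur.exists_bound {n : Type*} [Fintype n] [DecidableEq n] {A : Matrix n n ℝ}
    (hA : IsSchur A) : ∃ c r : ℝ, 0 ≤ r ∧ r < 1 ∧ ∀ (k : ℕ) (i j : n), |(A ^ k) i j| ≤ c * r ^ k := by
  obtain ⟨r, hr1, hr2⟩ := exists_between hA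
  have hrt : r ≠ ⊤ := ne_top_of_lt hr2
  lift r to NNReal using hrt
  have hr2' : (r : ℝ) < 1 := by exact_mod_cast hr2
  set Ac := A.map (fun a : ℝ => (a : ℂ)) with hAc
  have hlim := spectrum.pow_nnnorm_pow_one_div_tendsto_nhds_spectralRadius Ac
  have hev := hlim.eventually (gt_mem_nhds hr1)
  obtain ⟨N, hN⟩ := eventually_atTop.1 hev
  have hpow : ∀ k ≥ N + 1, ‖Ac ^ k‖ ≤ (r : ℝ) ^ k := by
    intro k hk
    have h1 := (hN k (by omega)).le
    have hk0 : (0 : ℝ) < k := by exact_mod_cast (by omega : 0 < k)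
    have h2 := ENNReal.rpow_le_rpow h1 hk0.le
    rw [← ENNReal.rpow_mul, one_div, inv_mul_cancel₀ hk0.ne', ENNReal.rpow_one,
      ENNReal.rpow_natCast] at h2
    exact_mod_cast h2
  have hr0 : 0 < (r : ℝ) := by
    have : (0 : ENNReal) < r := lt_of_le_of_lt zero_le hr1
    exact_mod_cast this
  have hent : ∀ (k : ℕ) (i j : n), |(A ^ k) i j| ≤ ‖Ac ^ k‖ := by
    intro k i j
    have e : Ac ^ k = (A ^ k).map (fun a : ℝ => (a : ℂ)) := by
      have := map_pow (Complex.ofRealHom.mapMatrix (m := n)) A k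
      exact this.symm
    have h3 : ‖(Ac ^ k) i j‖ ≤ ‖Ac ^ k‖ := by
      rw [Matrix.linfty_opNorm_def]
      have h5 : ‖(Ac ^ k) i j‖₊ ≤ ∑ j, ‖(Ac ^ k) i j‖₊ :=
        Finset.single_le_sum (f := fun j => ‖(Ac ^ k) i j‖₊) (fun _ _ => zero_le) (Finset.mem_univ j)
      have h6 := Finset.le_sup (f := fun i => ∑ j, ‖(Ac ^ k) i j‖₊) (Finset.mem_univ i)
      exact_mod_cast h5.trans h6
    rw [e] at h3 ⊢
    simpa using h3
  refine ⟨1 + ∑ k ∈ Finset.range (N + 1), ‖Ac ^ k‖ / (r : ℝ) ^ k, r, hr0.le, hr2', ?_⟩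
  intro k i j
  have hs : 0 ≤ ∑ k ∈ Finset.range (N + 1), ‖Ac ^ k‖ / (r : ℝ) ^ k :=
    Finset.sum_nonneg fun _ _ => by positivity
  refine (hent k i j).trans ?_
  rcases lt_or_ge k (N + 1) with hk | hk
  · have h4 : ‖Ac ^ k‖ / (r : ℝ) ^ k ≤ ∑ k ∈ Finset.range (N + 1), ‖Ac ^ k‖ / (r : ℝ) ^ k :=
      Finset.single_le_sum (f := fun k => ‖Ac ^ k‖ / (r : ℝ) ^ k) (fun _ _ => by positivity)
        (Finset.mem_range.2 hk)
    rw [div_le_iff₀ (by positivity)] at h4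
    nlinarith [pow_pos hr0 k]
  · nlinarith [pow_pos hr0 k, hpow k hk]

theorem IsSchur.summable_mulVec {n : Type*} [Fintype n] [DecidableEq n] {A : Matrix n n ℝ}
    (hA : IsSchur A) {w : ℤ → n → ℝ} {b : ℝ} (hw : ∀ t i, |w t i| ≤ b) (f : ℕ → ℤ) :
    Summable fun k : ℕ => (A ^ k) *ᵥ w (f k) := by
  obtain ⟨c, r, hr0, hr1, h⟩ := hA.exists_bound
  refine Pi.summable.2 fun i => ?_
  simp only [Matrix.mulVec, dotProduct]
  refine summable_sum fun j _ => ?_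
  refine Summable.of_norm_bounded (g := fun k => c * b * r ^ k)
    ((summable_geometric_of_lt_one hr0 hr1).mul_left _) fun k => ?_
  rw [Real.norm_eq_abs, abs_mul]
  calc _ ≤ (c * r ^ k) * b :=
        mul_le_mul (h k i j) (hw _ _) (abs_nonneg _) ((abs_nonneg _).trans (h k i j))
    _ = _ := by ring

theorem tsum_mulVec_step {n : Type*} [Fintype n] [DecidableEq n] {A : Matrix n n ℝ}
    {g : ℕ → n → ℝ} (h : Summable fun k : ℕ => (A ^ (k + 1)) *ᵥ g (k + 1))
    (h2 : Summable fun k : ℕ => (A ^ k) *ᵥ g (k + 1)) :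
    ∑' k : ℕ, (A ^ k) *ᵥ g k = A *ᵥ (∑' k : ℕ, (A ^ k) *ᵥ g (k + 1)) + g 0 := by
  have h1 : Summable fun k : ℕ => (A ^ k) *ᵥ g k := (summable_nat_add_iff 1).1 h
  rw [h1.tsum_eq_zero_add, add_comm]
  congr 1
  · have := h2.map_tsum (Matrix.mulVecLin A) (LinearMap.continuous_of_finiteDimensional _)
    simp only [Matrix.mulVecLin_apply] at this
    rw [this]
    exact tsum_congr fun k => by rw [Matrix.mulVec_mulVec, ← pow_succ']
  · simp

/-- `forwardSol` satisfies its recursion. -/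
theorem forwardSol_step {n : Type*} [Fintype n] [DecidableEq n] {A : Matrix n n ℝ}
    (hA : IsSchur A) {w : ℤ → n → ℝ} {b : ℝ} (hw : ∀ t i, |w t i| ≤ b) (t : ℤ) :
    forwardSol A w (t + 1) = A *ᵥ forwardSol A w t + w t := by
  have e : ∀ k : ℕ, t + 1 - 1 - ((k + 1 : ℕ) : ℤ) = t - 1 - k := fun k => by push_cast; ring
  have := tsum_mulVec_step (A := A) (g := fun k => w (t + 1 - 1 - k))
    ((summable_nat_add_iff 1).2 (hA.summable_mulVec hw fun k => t + 1 - 1 - k))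
    (hA.summable_mulVec hw fun k => t + 1 - 1 - ((k + 1 : ℕ) : ℤ))
  simp only [e] at this
  simpa [forwardSol] using this

/-- `backwardSol` satisfies its recursion. -/
theorem backwardSol_step {n : Type*} [Fintype n] [DecidableEq n] {A : Matrix n n ℝ}
    (hA : IsSchur A) {w : ℤ → n → ℝ} {b : ℝ} (hw : ∀ t i, |w t i| ≤ b) (t : ℤ) :
    backwardSol A w t = A *ᵥ backwardSol A w (t + 1) + w t := by
  have e : ∀ k : ℕ, t + ((k + 1 : ℕ) : ℤ) = t + 1 + k := fun k => by push_cast; ring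
  have := tsum_mulVec_step (A := A) (g := fun k => w (t + k))
    ((summable_nat_add_iff 1).2 (hA.summable_mulVec hw fun k => t + k))
    (hA.summable_mulVec hw fun k => t + ((k + 1 : ℕ) : ℤ))
  simp only [e] at this
  simpa [backwardSol] using this

theorem IsSchur.tendsto_tsum {n : Type*} [Fintype n] [DecidableEq n] {A : Matrix n n ℝ}
    (hA : IsSchur A) {w : ℤ → n → ℝ} {b : ℝ} (hw : ∀ t i, |w t i| ≤ b) (f : ℤ → ℕ → ℤ)
    (l : Filter ℤ) (hl : ∀ k, Tendsto (fun t => w (f t k)) l (𝓝 0)) :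
    Tendsto (fun t => ∑' k : ℕ, (A ^ k) *ᵥ w (f t k)) l (𝓝 0) := by
  obtain ⟨c, r, hr0, hr1, h⟩ := hA.exists_bound
  have h0 : (0 : n → ℝ) = ∑' k : ℕ, (A ^ k) *ᵥ (0 : n → ℝ) := by simp
  rw [h0]
  refine tendsto_tsum_of_dominated_convergence
    (bound := fun k => (Fintype.card n * (|c| * |b|)) * r ^ k)
    ((summable_geometric_of_lt_one hr0 hr1).mul_left _) (fun k => ?_)
    (Eventually.of_forall fun t k => ?_)
  · exact ((Matrix.mulVecLin (A ^ k)).continuous_of_finiteDimensional.tendsto 0).comp (hl k)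
  · rw [pi_norm_le_iff_of_nonneg (by positivity)]
    intro i
    simp only [Matrix.mulVec, dotProduct]
    refine (norm_sum_le _ _).trans ?_
    refine (Finset.sum_le_card_nsmul _ _ ((|c| * r ^ k) * |b|) fun j _ => ?_).trans ?_
    · rw [Real.norm_eq_abs, abs_mul]
      exact mul_le_mul ((h k i j).trans (by gcongr; exact le_abs_self c))
        ((hw _ _).trans (le_abs_self b)) (abs_nonneg _) (by positivity)
    · rw [nsmul_eq_mul, Finset.card_univ]
      exact le_of_eq (by ring)

/-- `forwardSol` vanishes at `-∞` if its input does. -/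
theorem forwardSol_tendsto {n : Type*} [Fintype n] [DecidableEq n] {A : Matrix n n ℝ}
    (hA : IsSchur A) {w : ℤ → n → ℝ} {b : ℝ} (hw : ∀ t i, |w t i| ≤ b)
    (h0 : Tendsto w atBot (𝓝 0)) : Tendsto (forwardSol A w) atBot (𝓝 0) :=
  hA.tendsto_tsum hw (fun t k => t - 1 - k) atBot fun k => h0.comp <| by
    simpa [sub_eq_add_neg] using tendsto_atBot_add_const_right atBot (-(k : ℤ))
      (tendsto_atBot_add_const_right atBot (-1 : ℤ) tendsto_id)

/-- `backwardSol` vanishes at `+∞` if its input does. -/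
theorem backwardSol_tendsto {n : Type*} [Fintype n] [DecidableEq n] {A : Matrix n n ℝ}
    (hA : IsSchur A) {w : ℤ → n → ℝ} {b : ℝ} (hw : ∀ t i, |w t i| ≤ b)
    (h0 : Tendsto w atTop (𝓝 0)) : Tendsto (backwardSol A w) atTop (𝓝 0) :=
  hA.tendsto_tsum hw (fun t k => t + k) atTop fun k => h0.comp <|
    tendsto_atTop_add_const_right atTop (k : ℤ) tendsto_id

end Signals

namespace LTISystem

variable {n m p : Type*} [Fintype n] [DecidableEq n] [Fintype m]

/-- The system is causal and stable: its state matrix is Schur. -/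
def IsStable (G : LTISystem n m p) : Prop := IsSchur G.A

/-- The output generated by the input `d` from `x (-∞) = 0`. -/
def output (G : LTISystem n m p) (d : ℤ → m → ℝ) : ℤ → p → ℝ := fun t =>
  G.C *ᵥ forwardSol G.A (fun s => G.B *ᵥ d s) t + G.D *ᵥ d t

/-- The transfer function `G(z) = C (z I - A)⁻¹ B + D`. -/
def transfer (G : LTISystem n m p) (z : ℂ) : Matrix p m ℂ :=
  G.C.map (fun a : ℝ => (a : ℂ)) * (z • (1 : Matrix n n ℂ) - G.A.map (fun a : ℝ => (a : ℂ)))⁻¹ *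
    G.B.map (fun a : ℝ => (a : ℂ)) + G.D.map (fun a : ℝ => (a : ℂ))

open scoped Matrix.Norms.L2Operator in
/-- The `H∞` norm of a stable system: the largest value over `θ ∈ [0, 2π]` of the maximal singular
value (the operator norm induced by the Euclidean norms) of `G(e^{jθ})`. -/
def hinfNorm [Fintype p] [DecidableEq m] (G : LTISystem n m p) : ℝ :=
  ⨆ θ : Set.Icc (0 : ℝ) (2 * Real.pi), ‖G.transfer (Complex.exp ((θ : ℝ) * Complex.I))‖

/-- The series connection `G₁ G₂`: the input enters `G₂`, whose output drives `G₁`. -/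
def series {n₁ n₂ m q p : Type*} [Fintype q]
    (G₁ : LTISystem n₁ q p) (G₂ : LTISystem n₂ m q) : LTISystem (n₁ ⊕ n₂) m p where
  A := fromBlocks G₁.A (G₁.B * G₂.C) 0 G₂.A
  B := fromRows (G₁.B * G₂.D) G₂.B
  C := fromCols G₁.C (G₁.D * G₂.C)
  D := G₁.D * G₂.D

/-- The inverse system of a square system (for invertible `D`). -/
def inverse [DecidableEq m] (F : LTISystem n m m) : LTISystem n m m where
  A := F.A - F.B * F.D⁻¹ * F.C
  B := F.B * F.D⁻¹
  C := -(F.D⁻¹ * F.C)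
  D := F.D⁻¹

end LTISystem

namespace Plant

variable {nx nd nu ne ny : Type*}
  [Fintype nx] [DecidableEq nx] [Fintype nd] [DecidableEq nd] [Fintype nu] [DecidableEq nu]
  [Fintype ne] [DecidableEq ne] [Fintype ny] [DecidableEq ny]

/-- The feedback interconnection `F_L(P, K)` from `d` to `e`, with the causal output-feedback
controller `K` (input `y`, output `u`) closed around the lower channels of `P`. -/
def lowerLFT {nK : Type*} [Fintype nK] (P : Plant nx nd nu ne ny) (K : LTISystem nK ny nu) :
    LTISystem (nx ⊕ nK) nd ne where
  A := fromBlocks (P.A + P.Bu * K.D * P.Cy) (P.Bu * K.C) (K.B * P.Cy) K.A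
  B := fromRows (P.Bd + P.Bu * K.D * P.Dyd) (K.B * P.Dyd)
  C := fromCols (P.Ce + P.Deu * K.D * P.Cy) (P.Deu * K.C)
  D := P.Deu * K.D * P.Dyd

/-- The weighted plant, obtained from `P` by driving its disturbance channel by the output of
the system `W`: `d = W d̂`. -/
def weighted {nW : Type*} (P : Plant nx nd nu ne ny) (W : LTISystem nW nd nd) :
    Plant (nx ⊕ nW) nd nu ne ny where
  A := fromBlocks P.A (P.Bd * W.C) 0 W.A
  Bd := fromRows (P.Bd * W.D) W.B
  Bu := fromRows P.Bu 0
  Ce := fromCols P.Ce 0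
  Deu := P.Deu
  Cy := fromCols P.Cy (P.Dyd * W.C)
  Dyd := P.Dyd * W.D

/-- `Q = Ceᵀ Ce`. -/
def Q (P : Plant nx nd nu ne ny) : Matrix nx nx ℝ := P.Ceᵀ * P.Ce

/-- `S = Ceᵀ Deu`. -/
def S (P : Plant nx nd nu ne ny) : Matrix nx nu ℝ := P.Ceᵀ * P.Deu

/-- `R = Deuᵀ Deu`. -/
def R (P : Plant nx nd nu ne ny) : Matrix nu nu ℝ := P.Deuᵀ * P.Deu

/-- The regularity conditions on `(A, Bu, Ce, Deu)` under which the benchmark is defined. -/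
structure Regular (P : Plant nx nd nu ne ny) : Prop where
  posDef : P.R.PosDef
  stabilizable : ∃ L : Matrix nu nx ℝ, IsSchur (P.A - P.Bu * L)
  nonsingular : IsUnit (P.A - P.Bu * P.R⁻¹ * P.Sᵀ)
  fullColumnRank : ∀ θ ∈ Set.Icc (0 : ℝ) (2 * Real.pi),
    (fromBlocks
      (P.A.map (fun a : ℝ => (a : ℂ)) - Complex.exp (θ * Complex.I) • (1 : Matrix nx nx ℂ))
      (P.Bu.map (fun a : ℝ => (a : ℂ)))
      (P.Ce.map (fun a : ℝ => (a : ℂ)))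
      (P.Deu.map (fun a : ℝ => (a : ℂ)))).rank = Fintype.card (nx ⊕ nu)

/-- `H = R + Buᵀ X Bu`. -/
def H (P : Plant nx nd nu ne ny) (X : Matrix nx nx ℝ) : Matrix nu nu ℝ :=
  P.R + P.Buᵀ * X * P.Bu

/-- `Kx = H⁻¹ (Aᵀ X Bu + S)ᵀ`. -/
def Kx (P : Plant nx nd nu ne ny) (X : Matrix nx nx ℝ) : Matrix nu nx ℝ :=
  (P.H X)⁻¹ * (P.Aᵀ * X * P.Bu + P.S)ᵀ

/-- `Kv = H⁻¹ Buᵀ`. -/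
def Kv (P : Plant nx nd nu ne ny) (X : Matrix nx nx ℝ) : Matrix nu nx ℝ :=
  (P.H X)⁻¹ * P.Buᵀ

/-- `Kd = H⁻¹ Buᵀ X Bd`. -/
def Kd (P : Plant nx nd nu ne ny) (X : Matrix nx nx ℝ) : Matrix nu nd ℝ :=
  (P.H X)⁻¹ * P.Buᵀ * X * P.Bd

/-- `X ⪰ 0` is a stabilizing solution of the discrete-time algebraic Riccati equation
`0 = X - Aᵀ X A - Q + (Aᵀ X Bu + S) (R + Buᵀ X Bu)⁻¹ (Aᵀ X Bu + S)ᵀ`. -/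
structure IsStabilizingSolution (P : Plant nx nd nu ne ny) (X : Matrix nx nx ℝ) : Prop where
  posSemidef : X.PosSemidef
  dare : 0 = X - P.Aᵀ * X * P.A - P.Q +
    (P.Aᵀ * X * P.Bu + P.S) * (P.R + P.Buᵀ * X * P.Bu)⁻¹ * (P.Aᵀ * X * P.Bu + P.S)ᵀ
  schur : IsSchur (P.A - P.Bu * P.Kx X)

/-! The closed loop of the plant with the optimal non-causal controller `Kᵒ`:
`v t = (A - Bu Kx)ᵀ (v (t+1) + X Bd d t)`, `v (+∞) = 0`,
`u t = -Kx x t - Kv v (t+1) - Kd d t`,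
`x (t+1) = A x t + Bd d t + Bu u t`, `x (-∞) = 0`. -/

/-- The anticausal state `v` of `Kᵒ`. -/
def ncCostate (P : Plant nx nd nu ne ny) (X : Matrix nx nx ℝ) (d : ℤ → nd → ℝ) : ℤ → nx → ℝ :=
  backwardSol (P.A - P.Bu * P.Kx X)ᵀ
    (fun t => (P.A - P.Bu * P.Kx X)ᵀ *ᵥ ((X * P.Bd) *ᵥ d t))

/-- The plant state under `Kᵒ`, i.e. the solution of
`x (t+1) = (A - Bu Kx) x t + Bd d t - Bu (Kv v (t+1) + Kd d t)` with `x (-∞) = 0`. -/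
def ncState (P : Plant nx nd nu ne ny) (X : Matrix nx nx ℝ) (d : ℤ → nd → ℝ) : ℤ → nx → ℝ :=
  forwardSol (P.A - P.Bu * P.Kx X) (fun t => P.Bd *ᵥ d t -
    P.Bu *ᵥ (P.Kv X *ᵥ P.ncCostate X d (t + 1) + P.Kd X *ᵥ d t))

/-- The control signal generated by `Kᵒ`. -/
def ncInput (P : Plant nx nd nu ne ny) (X : Matrix nx nx ℝ) (d : ℤ → nd → ℝ) : ℤ → nu → ℝ :=
  fun t => -(P.Kx X *ᵥ P.ncState X d t) - P.Kv X *ᵥ P.ncCostate X d (t + 1) - P.Kd X *ᵥ d t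

/-- The error signal under `Kᵒ`. -/
def ncError (P : Plant nx nd nu ne ny) (X : Matrix nx nx ℝ) (d : ℤ → nd → ℝ) : ℤ → ne → ℝ :=
  fun t => P.Ce *ᵥ P.ncState X d t + P.Deu *ᵥ P.ncInput X d t

/-- The benchmark cost `J(Kᵒ, d)`. -/
def ncCost (P : Plant nx nd nu ne ny) (X : Matrix nx nx ℝ) (d : ℤ → nd → ℝ) : ℝ :=
  energy (P.ncError X d)

variable {nK nF : Type*} [Fintype nK] [DecidableEq nK] [Fintype nF] [DecidableEq nF]

/-- The cost `J(K, d) = ‖F_L(P, K) d‖₂²`. -/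
def cost (P : Plant nx nd nu ne ny) (K : LTISystem nK ny nu) (d : ℤ → nd → ℝ) : ℝ :=
  energy ((P.lowerLFT K).output d)

/-- `K` achieves `(γd, γJ)`-regret relative to `Kᵒ`: the closed loop is stable and
`J(K, d) < γd² ‖d‖² + γJ² J(Kᵒ, d)` holds with a uniform margin `ε ‖d‖²`, `ε > 0`. -/
def AchievesRegret (P : Plant nx nd nu ne ny) (X : Matrix nx nx ℝ) (γd γJ : ℝ)
    (K : LTISystem nK ny nu) : Prop :=
  (P.lowerLFT K).IsStable ∧ ∃ ε : ℝ, 0 < ε ∧ ∀ d : ℤ → nd → ℝ, IsL2 d →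
    P.cost K d + ε * energy d ≤ γd ^ 2 * energy d + γJ ^ 2 * P.ncCost X d

/-- The same with strict inequality for each nonzero `d` separately, without a uniform margin. -/
def AchievesPointwiseRegret (P : Plant nx nd nu ne ny) (X : Matrix nx nx ℝ) (γd γJ : ℝ)
    (K : LTISystem nK ny nu) : Prop :=
  (P.lowerLFT K).IsStable ∧ ∀ d : ℤ → nd → ℝ, IsL2 d → d ≠ 0 →
    P.cost K d < γd ^ 2 * energy d + γJ ^ 2 * P.ncCost X d

/-- The `H∞` synthesis specification: `F_L(P, K)` is stable with `‖F_L(P, K)‖∞ < γ`. -/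
def AchievesHinf (P : Plant nx nd nu ne ny) (γ : ℝ) (K : LTISystem nK ny nu) : Prop :=
  (P.lowerLFT K).IsStable ∧ (P.lowerLFT K).hinfNorm < γ

/-- Additive regret: `J(K, d) - J(Kᵒ, d) < γ² ‖d‖²` with a uniform margin. -/
def AchievesAdditiveRegret (P : Plant nx nd nu ne ny) (X : Matrix nx nx ℝ) (γ : ℝ)
    (K : LTISystem nK ny nu) : Prop :=
  (P.lowerLFT K).IsStable ∧ ∃ ε : ℝ, 0 < ε ∧ ∀ d : ℤ → nd → ℝ, IsL2 d →
    P.cost K d - P.ncCost X d ≤ (γ ^ 2 - ε) * energy d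

/-- Competitive ratio: `J(K, d) / J(Kᵒ, d)` is bounded, uniformly in `d ≠ 0`, by a number smaller
than `γ²`; the ratio has to make sense. -/
def AchievesCompetitiveRatio (P : Plant nx nd nu ne ny) (X : Matrix nx nx ℝ) (γ : ℝ)
    (K : LTISystem nK ny nu) : Prop :=
  (P.lowerLFT K).IsStable ∧ ∃ ρ : ℝ, ρ < γ ^ 2 ∧ ∀ d : ℤ → nd → ℝ, IsL2 d → d ≠ 0 →
    0 < P.ncCost X d ∧ P.cost K d / P.ncCost X d ≤ ρ

/-- `F` is a spectral factor of the benchmark `γd² ‖d‖² + γJ² J(Kᵒ, d) = ‖F d‖²`: it is square,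
causal, stable and invertible, and its inverse is causal and stable. -/
structure IsSpectralFactor (P : Plant nx nd nu ne ny) (X : Matrix nx nx ℝ) (γd γJ : ℝ)
    (F : LTISystem nF nd nd) : Prop where
  stable : F.IsStable
  invertible : IsUnit F.D
  inverse_stable : F.inverse.IsStable
  energy_eq : ∀ d : ℤ → nd → ℝ, IsL2 d →
    γd ^ 2 * energy d + γJ ^ 2 * P.ncCost X d = energy (F.output d)

end Plant

end

/-!
Everything rests on one identity: the `H∞` norm of a stable system is its gain on two-sided
square-summable signals (`LTISystem.IsStable.hinfNorm_le_iff`). A strict bound on the norm is then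
the gain bound with a uniform margin (`LTISystem.IsStable.hinfNorm_lt_iff`).

* The gain is at most the norm. For an absolutely summable input the Fourier transform turns the
  state equation into `z x̂ = A x̂ + B d̂` on the unit circle, so the transform of the output is
  `G(z) d̂`, and Parseval's identity compares the energies. A square-summable input is truncated to
  finite sets of times; the outputs converge at each time, and the bound passes to finite sums of
  output energies.
* The norm is at most the gain. For `1 < ‖z‖` the input `v z ^ t`, `t < 0`, has finite energy, and
  at negative times its output is exactly `G(z) v z ^ t`. Comparing energies gives
  `‖G(z) v‖ ≤ c ‖v‖` outside the closed disc, and the bound reaches the unit circle by continuity.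

A bounded solution of a Schur recursion is unique (`IsSchur.forwardSol_eq_of_recursion`). Hence the
output of a series connection is the composition of the outputs, and a system and its inverse
cancel, since in each case the trajectories of the parts solve the recursion of the whole.

For the spectral factor `F` the substitution `w = F d` is therefore a bijection of `ℓ₂`, bounded in
both directions. It turns the benchmark into `‖w‖²` and the closed-loop cost into the energy of
`F_L(P, K) F⁻¹ w`, so that regret bounds for `P` are gain bounds for the weighted closed loop
(`Plant.IsSpectralFactor.achievesRegret_iff`). The closed loop of the weighted plant is this series
connection with its states reordered. For `γd = 0` the same two-sided bound on `F` makes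
`γJ² J(Kᵒ, d)` comparable with `‖d‖²`, which exchanges a margin in the ratio for one in the energy.
-/

/-! ### Signals -/

section SignalLemmas

variable {ι κ : Type*}

/-- A two-sided vector sequence with uniformly bounded entries. -/
def IsBoundedSignal (w : ℤ → ι → ℝ) : Prop := ∃ b : ℝ, ∀ t i, |w t i| ≤ b

theorem IsBoundedSignal.add {w w' : ℤ → ι → ℝ} (hw : IsBoundedSignal w)
    (hw' : IsBoundedSignal w') : IsBoundedSignal fun t => w t + w' t := by
  obtain ⟨b, hb⟩ := hw
  obtain ⟨b', hb'⟩ := hw'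
  exact ⟨b + b', fun t i => (abs_add_le _ _).trans (add_le_add (hb t i) (hb' t i))⟩

theorem IsBoundedSignal.sumElim {w : ℤ → ι → ℝ} {w' : ℤ → κ → ℝ} (hw : IsBoundedSignal w)
    (hw' : IsBoundedSignal w') : IsBoundedSignal fun t => Sum.elim (w t) (w' t) := by
  obtain ⟨b, hb⟩ := hw
  obtain ⟨b', hb'⟩ := hw'
  refine ⟨max b b', fun t i => ?_⟩
  cases i with
  | inl i => exact (hb t i).trans (le_max_left _ _)
  | inr i => exact (hb' t i).trans (le_max_right _ _)

variable [Fintype ι] [Fintype κ]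

theorem dotProduct_self_eq_sum_sq (v : ι → ℝ) : v ⬝ᵥ v = ∑ i, v i ^ 2 := by
  simp [dotProduct, sq]

theorem dotProduct_self_nonneg_real (v : ι → ℝ) : 0 ≤ v ⬝ᵥ v := by
  rw [dotProduct_self_eq_sum_sq]; positivity

theorem energy_nonneg (w : ℤ → ι → ℝ) : 0 ≤ energy w :=
  tsum_nonneg fun _ => dotProduct_self_nonneg_real _

theorem energy_zero : energy (0 : ℤ → ι → ℝ) = 0 := by simp [energy]

theorem energy_pos {w : ℤ → ι → ℝ} (hw : IsL2 w) (h0 : w ≠ 0) : 0 < energy w := by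
  obtain ⟨t, ht⟩ := Function.ne_iff.1 h0
  refine hw.tsum_pos (fun _ => dotProduct_self_nonneg_real _) t ?_
  exact lt_of_le_of_ne (dotProduct_self_nonneg_real _)
    fun h => ht (dotProduct_self_eq_zero.1 h.symm)

theorem IsL2.isBoundedSignal {w : ℤ → ι → ℝ} (hw : IsL2 w) : IsBoundedSignal w := by
  refine ⟨√(energy w), fun t i => Real.abs_le_sqrt ?_⟩
  have h1 : w t i ^ 2 ≤ w t ⬝ᵥ w t := by
    rw [dotProduct_self_eq_sum_sq]
    exact Finset.single_le_sum (f := fun i => w t i ^ 2) (fun _ _ => sq_nonneg _)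
      (Finset.mem_univ i)
  exact h1.trans (hw.le_tsum t fun _ _ => dotProduct_self_nonneg_real _)

theorem isBoundedSignal_iff_norm {w : ℤ → ι → ℝ} :
    IsBoundedSignal w ↔ ∃ b : ℝ, 0 ≤ b ∧ ∀ t, ‖w t‖ ≤ b := by
  constructor
  · rintro ⟨b, hb⟩
    refine ⟨|b|, abs_nonneg b, fun t => (pi_norm_le_iff_of_nonneg (abs_nonneg b)).2 fun i => ?_⟩
    exact (hb t i).trans (le_abs_self b)
  · rintro ⟨b, -, hb⟩
    exact ⟨b, fun t i => (norm_le_pi_norm (w t) i).trans (hb t)⟩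

theorem Matrix.exists_norm_mulVec_le (M : Matrix κ ι ℝ) :
    ∃ c : ℝ, 0 ≤ c ∧ ∀ v : ι → ℝ, ‖M *ᵥ v‖ ≤ c * ‖v‖ := by
  classical
  exact ⟨‖LinearMap.toContinuousLinearMap M.mulVecLin‖, norm_nonneg _, fun v =>
    (LinearMap.toContinuousLinearMap M.mulVecLin).le_opNorm v⟩

theorem IsBoundedSignal.mulVec {w : ℤ → ι → ℝ} (hw : IsBoundedSignal w) (M : Matrix κ ι ℝ) :
    IsBoundedSignal fun t => M *ᵥ w t := by
  rw [isBoundedSignal_iff_norm] at hw ⊢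
  obtain ⟨b, hb0, hb⟩ := hw
  obtain ⟨c, hc0, hc⟩ := M.exists_norm_mulVec_le
  exact ⟨c * b, by positivity, fun t => (hc _).trans (by gcongr; exact hb t)⟩

theorem isL2_of_summable {w : ℤ → ι → ℝ} (hw : Summable w) : IsL2 w := by
  unfold IsL2
  simp only [dotProduct]
  refine summable_sum fun i _ => ?_
  have h := Pi.summable.1 hw i
  obtain ⟨b, hb⟩ := h.norm.tendsto_cofinite_zero.bddAbove_range_of_cofinite
  refine Summable.of_norm_bounded (g := fun t => b * ‖w t i‖) (h.norm.mul_left b) fun t => ?_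
  rw [norm_mul]
  exact mul_le_mul_of_nonneg_right (hb ⟨t, rfl⟩) (norm_nonneg _)

end SignalLemmas

/-! ### Schur matrices and their recursions -/

section Schur

variable {n : Type*} [Fintype n] [DecidableEq n]

theorem isSchur_iff {A : Matrix n n ℝ} :
    IsSchur A ↔ ∀ z : ℂ, (A.map (fun a : ℝ => (a : ℂ))).charpoly.IsRoot z → ‖z‖ < 1 := by
  unfold IsSchur spectralRadius
  set M := A.map (fun a : ℝ => (a : ℂ))
  constructor
  · intro h z hz
    have h1 : (‖z‖₊ : ENNReal) < 1 :=
      lt_of_le_of_lt (le_iSup₂ (f := fun z (_ : z ∈ spectrum ℂ M) => (‖z‖₊ : ENNReal)) z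
        (Matrix.mem_spectrum_iff_isRoot_charpoly.2 hz)) h
    exact_mod_cast h1
  · intro h
    have hs : ∀ z : ℂ, z ∈ spectrum ℂ M ↔ z ∈ M.charpoly.roots.toFinset := fun z => by
      rw [Matrix.mem_spectrum_iff_isRoot_charpoly, Multiset.mem_toFinset,
        Polynomial.mem_roots M.charpoly_monic.ne_zero]
    simp only [hs]
    rw [← Finset.sup_eq_iSup, Finset.sup_lt_iff (by simp)]
    intro z hz
    have := h z (Matrix.mem_spectrum_iff_isRoot_charpoly.1 ((hs z).2 hz))
    exact_mod_cast this

theorem isSchur_fromBlocks_zero₂₁ {m : Type*} [Fintype m] [DecidableEq m]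
    {A : Matrix n n ℝ} {B : Matrix n m ℝ} {D : Matrix m m ℝ} :
    IsSchur (fromBlocks A B 0 D) ↔ IsSchur A ∧ IsSchur D := by
  simp only [isSchur_iff, Matrix.fromBlocks_map]
  rw [show (0 : Matrix m n ℝ).map (fun a : ℝ => (a : ℂ)) = 0 by ext; simp,
    charpoly_fromBlocks_zero₂₁]
  simp only [Polynomial.root_mul]
  exact ⟨fun h => ⟨fun z hz => h z (.inl hz), fun z hz => h z (.inr hz)⟩,
    fun h z hz => hz.elim (h.1 z) (h.2 z)⟩

theorem isSchur_submatrix_equiv {m : Type*} [Fintype m] [DecidableEq m] (e : m ≃ n)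
    {A : Matrix n n ℝ} : IsSchur (A.submatrix e e) ↔ IsSchur A := by
  simp only [isSchur_iff]
  rw [show (A.submatrix e e).map (fun a : ℝ => (a : ℂ)) =
    Matrix.reindex e.symm e.symm (A.map (fun a : ℝ => (a : ℂ))) from rfl, charpoly_reindex]

theorem IsSchur.exists_norm_bound {A : Matrix n n ℝ} (hA : IsSchur A) :
    ∃ c r : ℝ, 0 ≤ c ∧ 0 ≤ r ∧ r < 1 ∧ ∀ (k : ℕ) (v : n → ℝ), ‖(A ^ k) *ᵥ v‖ ≤ c * r ^ k * ‖v‖ := by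
  obtain ⟨c, r, hr0, hr1, h⟩ := hA.exists_bound
  refine ⟨Fintype.card n * |c|, r, by positivity, hr0, hr1, fun k v => ?_⟩
  rw [pi_norm_le_iff_of_nonneg (by positivity)]
  intro i
  simp only [Matrix.mulVec, dotProduct]
  refine (norm_sum_le _ _).trans
    ((Finset.sum_le_card_nsmul _ _ ((|c| * r ^ k) * ‖v‖) fun j _ => ?_).trans ?_)
  · rw [norm_mul]
    exact mul_le_mul ((h k i j).trans (by gcongr; exact le_abs_self c)) (norm_le_pi_norm v j)
      (norm_nonneg _) (by positivity)
  · rw [nsmul_eq_mul, Finset.card_univ]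
    exact le_of_eq (by ring)

theorem IsSchur.isBoundedSignal_forwardSol {A : Matrix n n ℝ} (hA : IsSchur A) {w : ℤ → n → ℝ}
    (hw : IsBoundedSignal w) : IsBoundedSignal (forwardSol A w) := by
  obtain ⟨b, hb0, hb⟩ := isBoundedSignal_iff_norm.1 hw
  obtain ⟨c, r, hc0, hr0, hr1, h⟩ := hA.exists_norm_bound
  have hs := (summable_geometric_of_lt_one hr0 hr1).mul_left (c * b)
  refine isBoundedSignal_iff_norm.2 ⟨∑' k : ℕ, c * b * r ^ k,
    tsum_nonneg fun k => by positivity, fun t => tsum_of_norm_bounded hs.hasSum fun k => ?_⟩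
  calc _ ≤ c * r ^ k * ‖w (t - 1 - k)‖ := h k _
    _ ≤ c * r ^ k * b := by gcongr; exact hb _
    _ = _ := by ring

/-- A bounded solution of the recursion on the past of `t` is the one started at rest at `-∞`:
the sum defining `forwardSol` telescopes, and the remainder `A ^ N q (t - N)` tends to zero. -/
theorem IsSchur.forwardSol_eq_of_recursion {A : Matrix n n ℝ} (hA : IsSchur A)
    {w q : ℤ → n → ℝ} (hw : IsBoundedSignal w) (hq : IsBoundedSignal q) {t : ℤ}
    (h : ∀ s < t, q (s + 1) = A *ᵥ q s + w s) : forwardSol A w t = q t := by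
  obtain ⟨b, hb⟩ := hw
  have hs := hA.summable_mulVec hb fun k => t - 1 - k
  have hq0 : Tendsto (fun N : ℕ => (A ^ N) *ᵥ q (t - N)) atTop (𝓝 0) := by
    obtain ⟨b', hb'⟩ := hq
    exact (hA.summable_mulVec hb' fun k => t - k).tendsto_atTop_zero
  have hpart : ∀ N : ℕ, ∑ k ∈ Finset.range N, (A ^ k) *ᵥ w (t - 1 - k) =
      q t - (A ^ N) *ᵥ q (t - N) := by
    intro N
    induction N with
    | zero => simp
    | succ N ih =>
      have h1 := h (t - 1 - N) (by omega)
      rw [show t - 1 - (N : ℤ) + 1 = t - N by ring] at h1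
      rw [Finset.sum_range_succ, ih, h1, Matrix.mulVec_add, Matrix.mulVec_mulVec, ← pow_succ,
        show t - ((N + 1 : ℕ) : ℤ) = t - 1 - N by push_cast; ring]
      abel
  refine tendsto_nhds_unique hs.hasSum.tendsto_sum_nat ?_
  simp only [hpart]
  simpa using tendsto_const_nhds.sub hq0

end Schur

/-! ### Interconnections of stable systems -/

namespace LTISystem

theorem series_isStable_iff {n₁ n₂ m q p : Type*} [Fintype n₁] [DecidableEq n₁] [Fintype n₂]
    [DecidableEq n₂] [Fintype q] {G₁ : LTISystem n₁ q p} {G₂ : LTISystem n₂ m q} :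
    (G₁.series G₂).IsStable ↔ G₁.IsStable ∧ G₂.IsStable :=
  isSchur_fromBlocks_zero₂₁

/-- A coordinate change in the state space does not change the transfer function. -/
theorem transfer_eq_of_submatrix {n n' m p : Type*} [Fintype n] [DecidableEq n]
    [Fintype n'] [DecidableEq n'] (e : n' ≃ n)
    {G : LTISystem n m p} {G' : LTISystem n' m p} (hA : G'.A = G.A.submatrix e e)
    (hB : G'.B = G.B.submatrix e id) (hC : G'.C = G.C.submatrix id e) (hD : G'.D = G.D) :
    G'.transfer = G.transfer := by
  funext z
  have h1 : z • (1 : Matrix n' n' ℂ) - G'.A.map (fun a : ℝ => (a : ℂ)) =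
      (z • (1 : Matrix n n ℂ) - G.A.map (fun a : ℝ => (a : ℂ))).submatrix e e := by
    ext i j
    simp [hA, Matrix.one_apply]
  unfold transfer
  rw [h1, hB, hC, hD, inv_submatrix_equiv, ← submatrix_map, ← submatrix_map,
    submatrix_mul_equiv, submatrix_mul_equiv, submatrix_id_id]

variable {n m p : Type*} [Fintype n] [DecidableEq n] [Fintype m]

/-- The state trajectory driven by the input `d` from `x (-∞) = 0`. -/
noncomputable def state (G : LTISystem n m p) (d : ℤ → m → ℝ) : ℤ → n → ℝ :=
  forwardSol G.A fun s => G.B *ᵥ d s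

theorem output_apply (G : LTISystem n m p) (d : ℤ → m → ℝ) (t : ℤ) :
    G.output d t = G.C *ᵥ G.state d t + G.D *ᵥ d t := rfl

theorem output_zero (G : LTISystem n m p) : G.output 0 = 0 := by
  funext t
  simp [output, forwardSol]

theorem IsStable.isBoundedSignal_state {G : LTISystem n m p} (hG : G.IsStable) {d : ℤ → m → ℝ}
    (hd : IsBoundedSignal d) : IsBoundedSignal (G.state d) :=
  IsSchur.isBoundedSignal_forwardSol hG (hd.mulVec G.B)

theorem IsStable.state_step {G : LTISystem n m p} (hG : G.IsStable) {d : ℤ → m → ℝ}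
    (hd : IsBoundedSignal d) (t : ℤ) :
    G.state d (t + 1) = G.A *ᵥ G.state d t + G.B *ᵥ d t := by
  obtain ⟨b, hb⟩ := hd.mulVec G.B
  exact forwardSol_step hG hb t

theorem IsStable.state_eq {G : LTISystem n m p} (hG : G.IsStable) {d : ℤ → m → ℝ}
    (hd : IsBoundedSignal d) {q : ℤ → n → ℝ} (hq : IsBoundedSignal q)
    (h : ∀ s, q (s + 1) = G.A *ᵥ q s + G.B *ᵥ d s) : G.state d = q :=
  funext fun _ => IsSchur.forwardSol_eq_of_recursion hG (hd.mulVec G.B) hq fun s _ => h s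

theorem IsStable.isBoundedSignal_output [Fintype p] {G : LTISystem n m p} (hG : G.IsStable)
    {d : ℤ → m → ℝ} (hd : IsBoundedSignal d) : IsBoundedSignal (G.output d) :=
  ((hG.isBoundedSignal_state hd).mulVec G.C).add (hd.mulVec G.D)

theorem output_series {n₁ n₂ q : Type*} [Fintype n₁] [DecidableEq n₁] [Fintype n₂]
    [DecidableEq n₂] [Fintype q] {G₁ : LTISystem n₁ q p} {G₂ : LTISystem n₂ m q}
    (h₁ : G₁.IsStable) (h₂ : G₂.IsStable) {d : ℤ → m → ℝ} (hd : IsBoundedSignal d) :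
    (G₁.series G₂).output d = G₁.output (G₂.output d) := by
  have hy := h₂.isBoundedSignal_output hd
  have hx : (G₁.series G₂).state d =
      fun t => Sum.elim (G₁.state (G₂.output d) t) (G₂.state d t) := by
    refine IsStable.state_eq (series_isStable_iff.2 ⟨h₁, h₂⟩) hd
      ((h₁.isBoundedSignal_state hy).sumElim (h₂.isBoundedSignal_state hd)) fun s => ?_
    rw [h₁.state_step hy, h₂.state_step hd]
    simp only [series, fromBlocks_mulVec, fromRows_mulVec, output_apply]
    ext i
    cases i <;> simp [Matrix.mulVec_add, add_assoc]
  funext t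
  rw [output_apply, output_apply, hx]
  simp [series, fromCols_mulVec, output_apply, Matrix.mulVec_add, add_assoc]

/-- The inverse system undoes a stable system: both run on the same state trajectory. -/
theorem output_inverse_output [DecidableEq m] {F : LTISystem n m m} (hF : F.IsStable)
    (hD : IsUnit F.D) (hFi : F.inverse.IsStable) {d : ℤ → m → ℝ} (hd : IsBoundedSignal d) :
    F.inverse.output (F.output d) = d := by
  have hDD : F.D⁻¹ * F.D = 1 := nonsing_inv_mul _ ((isUnit_iff_isUnit_det _).1 hD)
  have hx : F.inverse.state (F.output d) = F.state d := by
    refine hFi.state_eq (hF.isBoundedSignal_output hd) (hF.isBoundedSignal_state hd) fun s => ?_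
    rw [hF.state_step hd]
    simp only [inverse, output_apply, Matrix.sub_mulVec, Matrix.mulVec_add, Matrix.mulVec_mulVec,
      Matrix.mul_assoc, hDD, Matrix.mul_one]
    abel
  funext t
  rw [output_apply, hx]
  simp [inverse, output_apply, Matrix.mulVec_add, hDD, Matrix.neg_mulVec]

/-- A stable system undoes its inverse system. -/
theorem output_output_inverse [DecidableEq m] {F : LTISystem n m m} (hF : F.IsStable)
    (hD : IsUnit F.D) (hFi : F.inverse.IsStable) {d : ℤ → m → ℝ} (hd : IsBoundedSignal d) :
    F.output (F.inverse.output d) = d := by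
  have hDD : F.D * F.D⁻¹ = 1 := mul_nonsing_inv _ ((isUnit_iff_isUnit_det _).1 hD)
  have hx : F.state (F.inverse.output d) = F.inverse.state d := by
    refine hF.state_eq (hFi.isBoundedSignal_output hd) (hFi.isBoundedSignal_state hd) fun s => ?_
    rw [hFi.state_step hd]
    simp only [inverse, output_apply, Matrix.sub_mulVec, Matrix.mulVec_add, Matrix.mulVec_mulVec,
      Matrix.mul_assoc, Matrix.neg_mulVec, Matrix.mulVec_neg]
    abel
  funext t
  rw [output_apply, hx]
  simp [inverse, output_apply, Matrix.mulVec_add, hDD, Matrix.neg_mulVec, Matrix.mulVec_neg,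
    ← Matrix.mul_assoc]

end LTISystem

namespace Plant

variable {nx nd nu ne ny nK nW : Type*} [Fintype nd] [Fintype nu] [Fintype ny] [Fintype nK]

/-- Reordering the state `(x, x_W, x_K)` of the weighted closed loop as `(x, x_K, x_W)`. -/
def weightedStateEquiv (nx nW nK : Type*) : (nx ⊕ nW) ⊕ nK ≃ (nx ⊕ nK) ⊕ nW :=
  (Equiv.sumAssoc nx nW nK).trans
    (((Equiv.refl nx).sumCongr (Equiv.sumComm nW nK)).trans (Equiv.sumAssoc nx nK nW).symm)

theorem lowerLFT_weighted_A (P : Plant nx nd nu ne ny) (W : LTISystem nW nd nd)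
    (K : LTISystem nK ny nu) : ((P.weighted W).lowerLFT K).A =
      ((P.lowerLFT K).series W).A.submatrix (weightedStateEquiv nx nW nK)
        (weightedStateEquiv nx nW nK) := by
  ext i j
  rcases i with (i | i) | i <;> rcases j with (j | j) | j <;>
    simp [weighted, lowerLFT, LTISystem.series, weightedStateEquiv, fromRows_mul, mul_fromCols,
      Matrix.mul_assoc, Matrix.add_mul]

theorem lowerLFT_weighted_B (P : Plant nx nd nu ne ny) (W : LTISystem nW nd nd)
    (K : LTISystem nK ny nu) : ((P.weighted W).lowerLFT K).B =
      ((P.lowerLFT K).series W).B.submatrix (weightedStateEquiv nx nW nK) id := by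
  ext i j
  rcases i with (i | i) | i <;>
    simp [weighted, lowerLFT, LTISystem.series, weightedStateEquiv, fromRows_mul,
      Matrix.mul_assoc, Matrix.add_mul]

theorem lowerLFT_weighted_C (P : Plant nx nd nu ne ny) (W : LTISystem nW nd nd)
    (K : LTISystem nK ny nu) : ((P.weighted W).lowerLFT K).C =
      ((P.lowerLFT K).series W).C.submatrix id (weightedStateEquiv nx nW nK) := by
  ext i j
  rcases j with (j | j) | j <;>
    simp [weighted, lowerLFT, LTISystem.series, weightedStateEquiv, mul_fromCols,
      Matrix.mul_assoc]

theorem lowerLFT_weighted_D (P : Plant nx nd nu ne ny) (W : LTISystem nW nd nd)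
    (K : LTISystem nK ny nu) : ((P.weighted W).lowerLFT K).D = ((P.lowerLFT K).series W).D := by
  simp [weighted, lowerLFT, LTISystem.series, Matrix.mul_assoc]

variable [Fintype nx] [DecidableEq nx] [DecidableEq nd] [Fintype ne] [DecidableEq nK]
  [Fintype nW] [DecidableEq nW]

/-- The closed loop of the weighted plant is the series connection of the closed loop with the
weight, up to the order of the states. -/
theorem achievesHinf_weighted_iff (P : Plant nx nd nu ne ny) (W : LTISystem nW nd nd)
    (K : LTISystem nK ny nu) (γ : ℝ) : (P.weighted W).AchievesHinf γ K ↔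
      ((P.lowerLFT K).series W).IsStable ∧ ((P.lowerLFT K).series W).hinfNorm < γ := by
  have ht := LTISystem.transfer_eq_of_submatrix _ (lowerLFT_weighted_A P W K)
    (lowerLFT_weighted_B P W K) (lowerLFT_weighted_C P W K) (lowerLFT_weighted_D P W K)
  unfold AchievesHinf LTISystem.IsStable LTISystem.hinfNorm
  rw [ht, lowerLFT_weighted_A, isSchur_submatrix_equiv]

end Plant

/-! ### The transfer function on and outside the unit circle -/

theorem IsSchur.isUnit_det_smul_one_sub {n : Type*} [Fintype n] [DecidableEq n]
    {A : Matrix n n ℝ} (hA : IsSchur A) {z : ℂ} (hz : 1 ≤ ‖z‖) :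
    IsUnit (z • (1 : Matrix n n ℂ) - A.map (fun a : ℝ => (a : ℂ))).det := by
  rw [isUnit_iff_ne_zero]
  intro h0
  refine absurd (isSchur_iff.1 hA z ?_) (not_lt.2 hz)
  rw [Polynomial.IsRoot, Matrix.eval_charpoly, ← h0, Matrix.smul_one_eq_diagonal]
  rfl

theorem sum_norm_sq_eq {ι : Type*} [Fintype ι] (v : ι → ℂ) :
    ∑ i, ‖v i‖ ^ 2 = ‖WithLp.toLp 2 v‖ ^ 2 := by
  rw [EuclideanSpace.norm_sq_eq]

namespace LTISystem

variable {n m p : Type*} [Fintype n] [DecidableEq n]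

theorem IsStable.continuousAt_transfer {G : LTISystem n m p} (hG : G.IsStable) {z : ℂ}
    (hz : 1 ≤ ‖z‖) : ContinuousAt G.transfer z := by
  have hdet : ContinuousAt
      (fun z : ℂ => (z • (1 : Matrix n n ℂ) - G.A.map (fun a : ℝ => (a : ℂ)))⁻¹) z := by
    have hc : Continuous fun z : ℂ => z • (1 : Matrix n n ℂ) - G.A.map (fun a : ℝ => (a : ℂ)) := by
      fun_prop
    simp only [Matrix.inv_def, Ring.inverse_eq_inv']
    exact (hc.matrix_det.continuousAt.inv₀ (hG.isUnit_det_smul_one_sub hz).ne_zero).smul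
      hc.matrix_adjugate.continuousAt
  unfold transfer
  have hmul : Continuous fun M : Matrix n n ℂ =>
      G.C.map (fun a : ℝ => (a : ℂ)) * M * G.B.map (fun a : ℝ => (a : ℂ)) +
        G.D.map (fun a : ℝ => (a : ℂ)) := by fun_prop
  exact hmul.continuousAt.comp (f := fun z : ℂ =>
    (z • (1 : Matrix n n ℂ) - G.A.map (fun a : ℝ => (a : ℂ)))⁻¹) hdet

variable [Fintype m]

theorem transfer_mulVec (G : LTISystem n m p) (z : ℂ) (v : m → ℂ) :
    G.transfer z *ᵥ v = G.C.map (fun a : ℝ => (a : ℂ)) *ᵥ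
      ((z • (1 : Matrix n n ℂ) - G.A.map (fun a : ℝ => (a : ℂ)))⁻¹ *ᵥ
        (G.B.map (fun a : ℝ => (a : ℂ)) *ᵥ v)) + G.D.map (fun a : ℝ => (a : ℂ)) *ᵥ v := by
  simp [transfer, Matrix.add_mulVec, Matrix.mulVec_mulVec, Matrix.mul_assoc]

open scoped Matrix.Norms.L2Operator in
theorem IsStable.bddAbove_hinfNorm [Fintype p] [DecidableEq m] {G : LTISystem n m p}
    (hG : G.IsStable) : BddAbove (Set.range fun θ : Set.Icc (0 : ℝ) (2 * Real.pi) =>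
      ‖G.transfer (Complex.exp ((θ : ℝ) * Complex.I))‖) := by
  refine (isCompact_range ?_).bddAbove
  refine continuous_iff_continuousAt.2 fun θ => ContinuousAt.norm ?_
  refine ContinuousAt.comp (g := G.transfer)
    (f := fun θ : Set.Icc (0 : ℝ) (2 * Real.pi) => Complex.exp ((θ : ℝ) * Complex.I))
    (hG.continuousAt_transfer (Complex.norm_exp_ofReal_mul_I _).ge) ?_
  fun_prop

open scoped Matrix.Norms.L2Operator in
theorem hinfNorm_nonneg [Fintype p] [DecidableEq m] (G : LTISystem n m p) : 0 ≤ G.hinfNorm :=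
  Real.iSup_nonneg fun _ => norm_nonneg _

open scoped Matrix.Norms.L2Operator in
theorem IsStable.norm_transfer_le [Fintype p] [DecidableEq m] {G : LTISystem n m p}
    (hG : G.IsStable) {z : ℂ} (hz : ‖z‖ = 1) : ‖G.transfer z‖ ≤ G.hinfNorm := by
  obtain ⟨θ, rfl⟩ := Complex.norm_eq_one_iff z |>.1 hz
  have hper : Function.Periodic (fun θ : ℝ => Complex.exp (θ * Complex.I)) (2 * Real.pi) := by
    intro θ
    simp [add_mul, Complex.exp_add, Complex.exp_two_pi_mul_I]
  obtain ⟨y, hy, h⟩ := hper.exists_mem_Ico₀ Real.two_pi_pos θ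
  rw [h]
  exact le_ciSup hG.bddAbove_hinfNorm ⟨y, Set.Ico_subset_Icc_self hy⟩

open scoped Matrix.Norms.L2Operator in
theorem IsStable.sum_norm_sq_transfer_mulVec_le [Fintype p] [DecidableEq m]
    {G : LTISystem n m p} (hG : G.IsStable) {z : ℂ} (hz : ‖z‖ = 1) (v : m → ℂ) :
    ∑ i, ‖(G.transfer z *ᵥ v) i‖ ^ 2 ≤ G.hinfNorm ^ 2 * ∑ i, ‖v i‖ ^ 2 := by
  rw [sum_norm_sq_eq, sum_norm_sq_eq, ← mul_pow]
  gcongr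
  exact (Matrix.l2_opNorm_mulVec (G.transfer z) (WithLp.toLp 2 v)).trans
    (mul_le_mul_of_nonneg_right (hG.norm_transfer_le hz) (norm_nonneg _))

end LTISystem

/-! ### Fourier series of absolutely summable signals -/

section Fourier

open MeasureTheory AddCircle

theorem norm_fourier_apply (t : ℤ) (x : UnitAddCircle) : ‖fourier t x‖ = 1 := by
  rw [fourier_apply]
  exact Circle.norm_coe _

theorem continuous_tsum_mul_fourier {a : ℤ → ℂ} (ha : Summable a) :
    Continuous fun x : UnitAddCircle => ∑' t, a t * fourier t x := by
  refine continuous_tsum (fun t => ?_) ha.norm fun t x => ?_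
  · exact continuous_const.mul (fourier t).continuous
  · rw [norm_mul, norm_fourier_apply, mul_one]

theorem summable_mul_fourier {a : ℤ → ℂ} (ha : Summable a) (x : UnitAddCircle) :
    Summable fun t => a t * fourier t x :=
  Summable.of_norm_bounded ha.norm fun t => by rw [norm_mul, norm_fourier_apply, mul_one]

/-- Parseval's identity for an absolutely summable sequence of coefficients. -/
theorem tsum_norm_sq_eq_integral {a : ℤ → ℂ} (ha : Summable a) :
    ∑' t, ‖a t‖ ^ 2 = ∫ x : UnitAddCircle, ‖∑' t, a t * fourier t x‖ ^ 2 ∂haarAddCircle := by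
  set f : C(UnitAddCircle, ℂ) := ⟨_, continuous_tsum_mul_fourier ha⟩ with hf
  have hsum : HasSum (fun t => a t • (fourier t : C(UnitAddCircle, ℂ))) f := by
    have h1 : Summable fun t => a t • (fourier t : C(UnitAddCircle, ℂ)) :=
      Summable.of_norm_bounded ha.norm fun t => by rw [norm_smul, fourier_norm, mul_one]
    convert h1.hasSum using 1
    ext x
    rw [← ContinuousMap.tsum_apply h1]
    rfl
  have hcoeff : ∀ t, fourierCoeff f t = a t := by
    intro k
    have h2 := hsum.mapL (ContinuousMap.toLp (E := ℂ) 2 haarAddCircle ℂ)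
    have h3 := h2.mapL (innerSL ℂ (fourierLp (T := 1) 2 k))
    have h4 : ∀ t, innerSL ℂ (fourierLp (T := 1) 2 k) (ContinuousMap.toLp (E := ℂ) 2
        haarAddCircle ℂ (a t • (fourier t : C(UnitAddCircle, ℂ)))) = if t = k then a t else 0 := by
      intro t
      have h5 := orthonormal_iff_ite.1 (orthonormal_fourier (T := 1)) k t
      rw [map_smul, map_smul, innerSL_apply_apply]
      refine (congrArg (a t • ·) h5).trans ?_
      simp [eq_comm]
    simp only [h4] at h3
    have h6 := h3.unique (hasSum_single k fun t ht => if_neg ht)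
    rw [if_pos rfl, innerSL_apply_apply] at h6
    rw [← h6, ← fourierCoeff_toLp, ← fourierBasis_repr, HilbertBasis.repr_apply_apply,
      coe_fourierBasis]
  have h := tsum_sq_fourierCoeff (ContinuousMap.toLp (E := ℂ) 2 haarAddCircle ℂ f)
  simp only [fourierCoeff_toLp, hcoeff] at h
  rw [h]
  refine integral_congr_ae ?_
  filter_upwards [ContinuousMap.coeFn_toLp (E := ℂ) (p := 2) (𝕜 := ℂ) haarAddCircle f] with x hx
  rw [hx]
  rfl

end Fourier

section FourierSum

open MeasureTheory AddCircle

/-- The discrete-time Fourier transform `∑ₜ w t e^{2πi t x}` of a real vector sequence. With this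
sign a time step forward is division by `e^{2πi x}`. -/
noncomputable def fourierSum {ι : Type*} (w : ℤ → ι → ℝ) (x : UnitAddCircle) : ι → ℂ :=
  fun i => ∑' t, (w t i : ℂ) * fourier t x

theorem Summable.ofReal_apply {ι : Type*} {w : ℤ → ι → ℝ} (hw : Summable w) (i : ι) :
    Summable fun t => (w t i : ℂ) :=
  Complex.ofRealCLM.summable (Pi.summable.1 hw i)

theorem summable_mulVec {ι κ : Type*} [Fintype ι] {w : ℤ → ι → ℝ} (hw : Summable w)
    (M : Matrix κ ι ℝ) : Summable fun t => M *ᵥ w t :=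
  Pi.summable.2 fun i => summable_sum fun j _ => (Pi.summable.1 hw j).mul_left (M i j)

theorem continuous_fourierSum {ι : Type*} {w : ℤ → ι → ℝ} (hw : Summable w) (i : ι) :
    Continuous fun x => fourierSum w x i :=
  continuous_tsum_mul_fourier (hw.ofReal_apply i)

theorem integrable_norm_sq_fourierSum {ι : Type*} {w : ℤ → ι → ℝ} (hw : Summable w) (i : ι) :
    Integrable (fun x => ‖fourierSum w x i‖ ^ 2) haarAddCircle :=
  ((continuous_fourierSum hw i).norm.pow 2).integrable_of_hasCompactSupport
    (HasCompactSupport.of_compactSpace _)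

theorem energy_eq_integral {ι : Type*} [Fintype ι] {w : ℤ → ι → ℝ} (hw : Summable w) :
    energy w = ∫ x : UnitAddCircle, ∑ i, ‖fourierSum w x i‖ ^ 2 ∂haarAddCircle := by
  rw [integral_finsetSum _ fun i _ => integrable_norm_sq_fourierSum hw i]
  unfold energy
  simp only [dotProduct_self_eq_sum_sq]
  rw [Summable.tsum_finsetSum]
  · refine Finset.sum_congr rfl fun i _ => ?_
    simp only [fourierSum]
    rw [← tsum_norm_sq_eq_integral (hw.ofReal_apply i)]
    simp
  · intro i _
    have h := isL2_of_summable (w := fun t (_ : Unit) => w t i)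
      (Pi.summable.2 fun _ => Pi.summable.1 hw i)
    simpa [IsL2, dotProduct, sq] using h

theorem fourierSum_add {ι : Type*} {w w' : ℤ → ι → ℝ} (hw : Summable w) (hw' : Summable w')
    (x : UnitAddCircle) :
    fourierSum (fun t => w t + w' t) x = fourierSum w x + fourierSum w' x := by
  ext i
  simp only [fourierSum, Pi.add_apply, Complex.ofReal_add, add_mul]
  exact (summable_mul_fourier (hw.ofReal_apply i) x).tsum_add
    (summable_mul_fourier (hw'.ofReal_apply i) x)

theorem fourierSum_mulVec {ι κ : Type*} [Fintype ι] {w : ℤ → ι → ℝ} (hw : Summable w)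
    (M : Matrix κ ι ℝ) (x : UnitAddCircle) :
    fourierSum (fun t => M *ᵥ w t) x = M.map (fun a : ℝ => (a : ℂ)) *ᵥ fourierSum w x := by
  ext i
  simp only [fourierSum, Matrix.mulVec, dotProduct, Matrix.map_apply, Complex.ofReal_sum,
    Complex.ofReal_mul, Finset.sum_mul]
  rw [Summable.tsum_finsetSum]
  · exact Finset.sum_congr rfl fun j _ => by simp only [mul_assoc, tsum_mul_left]
  · intro j _
    simp only [mul_assoc]
    exact (summable_mul_fourier (hw.ofReal_apply j) x).mul_left _

theorem fourierSum_shift {ι : Type*} (w : ℤ → ι → ℝ) (x : UnitAddCircle) :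
    fourierSum (fun t => w (t + 1)) x = (fourier 1 x : ℂ)⁻¹ • fourierSum w x := by
  have h1 : (fourier 1 x : ℂ) ≠ 0 := fun h => by simpa [h] using norm_fourier_apply 1 x
  ext i
  simp only [fourierSum, Pi.smul_apply, smul_eq_mul]
  rw [← (Equiv.addRight (1 : ℤ)).tsum_eq (fun t => (w t i : ℂ) * fourier t x), ← tsum_mul_left]
  refine tsum_congr fun t => ?_
  rw [Equiv.coe_addRight, fourier_add]
  field_simp

end FourierSum

/-! ### The `H∞` norm bounds the energy gain -/

/-- Convolution with the geometrically decaying powers of a Schur matrix preserves absolute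
summability. -/
theorem IsSchur.summable_forwardSol {n : Type*} [Fintype n] [DecidableEq n] {A : Matrix n n ℝ}
    (hA : IsSchur A) {w : ℤ → n → ℝ} (hw : Summable w) : Summable (forwardSol A w) := by
  obtain ⟨c, r, hc0, hr0, hr1, h⟩ := hA.exists_norm_bound
  have hprod : Summable fun q : ℤ × ℕ => c * (‖w q.1‖ * r ^ q.2) :=
    (hw.norm.mul_of_nonneg (summable_geometric_of_lt_one hr0 hr1) (fun _ => norm_nonneg _)
      fun k => by positivity).mul_left c
  let e : ℤ × ℕ ≃ ℤ × ℕ :=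
    { toFun := fun q => (q.1 - 1 - q.2, q.2)
      invFun := fun q => (q.1 + 1 + q.2, q.2)
      left_inv := fun q => Prod.ext (by ring) rfl
      right_inv := fun q => Prod.ext (by ring) rfl }
  have h2 : Summable fun q : ℤ × ℕ => (A ^ q.2) *ᵥ w (q.1 - 1 - q.2) := by
    refine Summable.of_norm_bounded (e.summable_iff.2 hprod) fun q => (h _ _).trans (le_of_eq ?_)
    simp only [e, Function.comp, Equiv.coe_fn_mk]
    ring
  exact h2.prod

theorem energy_indicator_le {m : Type*} [Fintype m] {d : ℤ → m → ℝ} (hd : IsL2 d) (s : Finset ℤ) :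
    energy ((s : Set ℤ).indicator d) ≤ energy d := by
  have h0 : ∀ t, (s : Set ℤ).indicator d t ⬝ᵥ (s : Set ℤ).indicator d t ≤ d t ⬝ᵥ d t := fun t => by
    by_cases hs : t ∈ (s : Set ℤ)
    · rw [Set.indicator_of_mem hs]
    · rw [Set.indicator_of_notMem hs]
      simpa using dotProduct_self_nonneg_real (d t)
  exact Summable.tsum_le_tsum h0
    (Summable.of_nonneg_of_le (fun _ => dotProduct_self_nonneg_real _) h0 hd) hd

namespace LTISystem

variable {n m p : Type*} [Fintype n] [DecidableEq n] [Fintype m]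

theorem IsStable.summable_state {G : LTISystem n m p} (hG : G.IsStable) {d : ℤ → m → ℝ}
    (hd : Summable d) : Summable (G.state d) :=
  IsSchur.summable_forwardSol hG (summable_mulVec hd G.B)

/-- The output at a fixed time is the limit of the outputs of the finite truncations of a bounded
input, by dominated convergence. -/
theorem IsStable.tendsto_output_indicator {G : LTISystem n m p} (hG : G.IsStable)
    {d : ℤ → m → ℝ} (hd : IsBoundedSignal d) (t : ℤ) :
    Tendsto (fun s : Finset ℤ => G.output ((s : Set ℤ).indicator d) t) atTop
      (𝓝 (G.output d t)) := by
  obtain ⟨b, hb0, hb⟩ := isBoundedSignal_iff_norm.1 (hd.mulVec G.B)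
  obtain ⟨c, r, hc0, hr0, hr1, h⟩ := IsSchur.exists_norm_bound hG
  have hev : ∀ u : ℤ, ∀ᶠ s : Finset ℤ in atTop, (s : Set ℤ).indicator d u = d u := fun u => by
    filter_upwards [eventually_ge_atTop {u}] with s hs
    exact Set.indicator_of_mem (Finset.mem_coe.2 (Finset.singleton_subset_iff.1 hs)) d
  refine Tendsto.add ?_ (tendsto_const_nhds.congr' ?_)
  · refine ((G.C.mulVecLin.continuous_of_finiteDimensional).tendsto _).comp ?_
    refine tendsto_tsum_of_dominated_convergence (bound := fun k => c * b * r ^ k)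
      ((summable_geometric_of_lt_one hr0 hr1).mul_left _) (fun k => ?_)
      (Eventually.of_forall fun s k => ?_)
    · refine tendsto_const_nhds.congr' ?_
      filter_upwards [hev (t - 1 - k)] with s hs
      rw [hs]
    · have h1 : ‖G.B *ᵥ (s : Set ℤ).indicator d (t - 1 - k)‖ ≤ b := by
        by_cases hs : t - 1 - (k : ℤ) ∈ (s : Set ℤ)
        · rw [Set.indicator_of_mem hs]
          exact hb _
        · simpa [Set.indicator_of_notMem hs] using hb0
      calc _ ≤ c * r ^ k * ‖G.B *ᵥ (s : Set ℤ).indicator d (t - 1 - k)‖ := h k _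
        _ ≤ c * r ^ k * b := by gcongr
        _ = _ := by ring
  · filter_upwards [hev t] with s hs
    rw [hs]

theorem IsStable.summable_output {G : LTISystem n m p} (hG : G.IsStable) {d : ℤ → m → ℝ}
    (hd : Summable d) : Summable (G.output d) :=
  (summable_mulVec (hG.summable_state hd) G.C).add (summable_mulVec hd G.D)

/-- In the frequency domain the output is the transfer function times the input: the transformed
state equation is solved by inverting `z I - A`. -/
theorem IsStable.fourierSum_output {G : LTISystem n m p} (hG : G.IsStable) {d : ℤ → m → ℝ}
    (hd : Summable d) (x : UnitAddCircle) :
    fourierSum (G.output d) x = G.transfer (fourier 1 x : ℂ)⁻¹ *ᵥ fourierSum d x := by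
  set z : ℂ := (fourier 1 x : ℂ)⁻¹ with hz
  have hx := hG.summable_state hd
  have hz1 : 1 ≤ ‖z‖ := by rw [hz, norm_inv, norm_fourier_apply, inv_one]
  have hstep : z • fourierSum (G.state d) x = G.A.map (fun a : ℝ => (a : ℂ)) *ᵥ
      fourierSum (G.state d) x + G.B.map (fun a : ℝ => (a : ℂ)) *ᵥ fourierSum d x := by
    rw [hz, ← fourierSum_shift, ← fourierSum_mulVec hx, ← fourierSum_mulVec hd,
      ← fourierSum_add (summable_mulVec hx _) (summable_mulVec hd _)]
    congr 1
    exact funext fun t => hG.state_step (isL2_of_summable hd).isBoundedSignal t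
  have hstate : (z • (1 : Matrix n n ℂ) - G.A.map (fun a : ℝ => (a : ℂ)))⁻¹ *ᵥ
      (G.B.map (fun a : ℝ => (a : ℂ)) *ᵥ fourierSum d x) = fourierSum (G.state d) x := by
    have h1 : G.B.map (fun a : ℝ => (a : ℂ)) *ᵥ fourierSum d x =
        (z • (1 : Matrix n n ℂ) - G.A.map (fun a : ℝ => (a : ℂ))) *ᵥ
          fourierSum (G.state d) x := by
      rw [Matrix.sub_mulVec, Matrix.smul_mulVec, Matrix.one_mulVec, hstep]
      abel
    rw [h1, Matrix.mulVec_mulVec, nonsing_inv_mul _ (hG.isUnit_det_smul_one_sub hz1),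
      Matrix.one_mulVec]
  rw [transfer_mulVec, hstate, ← fourierSum_mulVec hx, ← fourierSum_mulVec hd,
    ← fourierSum_add (summable_mulVec hx _) (summable_mulVec hd _)]
  rfl

variable [Fintype p]

theorem IsStable.energy_output_le_of_summable [DecidableEq m] {G : LTISystem n m p}
    (hG : G.IsStable) {d : ℤ → m → ℝ} (hd : Summable d) :
    energy (G.output d) ≤ G.hinfNorm ^ 2 * energy d := by
  rw [energy_eq_integral (hG.summable_output hd), energy_eq_integral hd,
    ← MeasureTheory.integral_const_mul]
  refine MeasureTheory.integral_mono
    (MeasureTheory.integrable_finsetSum _ fun i _ =>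
      integrable_norm_sq_fourierSum (hG.summable_output hd) i)
    ((MeasureTheory.integrable_finsetSum _ fun i _ =>
      integrable_norm_sq_fourierSum hd i).const_mul _) fun x => ?_
  simp only [hG.fourierSum_output hd]
  exact hG.sum_norm_sq_transfer_mulVec_le (by rw [norm_inv, norm_fourier_apply, inv_one]) _

/-- For an absolutely summable input this is Parseval's identity; the general case follows by
truncating the input and passing to the limit in each finite sum of output energies. -/
theorem IsStable.sum_output_le [DecidableEq m] {G : LTISystem n m p}
    (hG : G.IsStable) {d : ℤ → m → ℝ} (hd : IsL2 d) (u : Finset ℤ) :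
    ∑ t ∈ u, G.output d t ⬝ᵥ G.output d t ≤ G.hinfNorm ^ 2 * energy d := by
  have hlim : Tendsto (fun s : Finset ℤ => ∑ t ∈ u, G.output ((s : Set ℤ).indicator d) t ⬝ᵥ
      G.output ((s : Set ℤ).indicator d) t) atTop
      (𝓝 (∑ t ∈ u, G.output d t ⬝ᵥ G.output d t)) := by
    refine tendsto_finsetSum _ fun t _ => ?_
    have hc : Continuous fun v : p → ℝ => v ⬝ᵥ v := by fun_prop
    exact (hc.tendsto _).comp (hG.tendsto_output_indicator hd.isBoundedSignal t)
  refine le_of_tendsto hlim (Eventually.of_forall fun s => ?_)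
  have hs : Summable ((s : Set ℤ).indicator d) :=
    summable_of_ne_finset_zero (s := s) fun t ht => Set.indicator_of_notMem (by simpa using ht) d
  calc _ ≤ energy (G.output ((s : Set ℤ).indicator d)) :=
        (isL2_of_summable (hG.summable_output hs)).sum_le_tsum u
          fun _ _ => dotProduct_self_nonneg_real _
    _ ≤ G.hinfNorm ^ 2 * energy ((s : Set ℤ).indicator d) := hG.energy_output_le_of_summable hs
    _ ≤ _ := by gcongr; exact energy_indicator_le hd s

theorem IsStable.isL2_output [DecidableEq m] {G : LTISystem n m p} (hG : G.IsStable)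
    {d : ℤ → m → ℝ} (hd : IsL2 d) : IsL2 (G.output d) :=
  summable_of_sum_le (fun _ => dotProduct_self_nonneg_real _) (hG.sum_output_le hd)

theorem IsStable.energy_output_le [DecidableEq m] {G : LTISystem n m p} (hG : G.IsStable)
    {d : ℤ → m → ℝ} (hd : IsL2 d) : energy (G.output d) ≤ G.hinfNorm ^ 2 * energy d :=
  (hG.isL2_output hd).tsum_le_of_sum_le (hG.sum_output_le hd)

end LTISystem

/-! ### The energy gain bounds the `H∞` norm -/

/-- The real part of the exponential `v z ^ t`, switched off from time `0` on; square summable for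
`1 < ‖z‖`. -/
noncomputable def pastExponential {ι : Type*} (z : ℂ) (v : ι → ℂ) : ℤ → ι → ℝ :=
  fun t i => if t < 0 then (v i * z ^ t).re else 0

theorem sq_re_add_sq_re_neg_I_mul (a : ℂ) : a.re ^ 2 + (-Complex.I * a).re ^ 2 = ‖a‖ ^ 2 := by
  rw [Complex.sq_norm, Complex.normSq_apply]
  simp
  ring

theorem Matrix.mulVec_re {ι κ : Type*} [Fintype ι] (M : Matrix κ ι ℝ) (v : ι → ℂ) (a : ℂ) :
    (M *ᵥ fun i => (v i * a).re) =
      fun i => ((M.map (fun a : ℝ => (a : ℂ)) *ᵥ v) i * a).re := by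
  ext i
  simp only [Matrix.mulVec, dotProduct, Finset.sum_mul, Complex.re_sum, Matrix.map_apply]
  exact Finset.sum_congr rfl fun j _ => by rw [mul_assoc, Complex.re_ofReal_mul]

theorem summable_norm_zpow_sq_of_neg {z : ℂ} (hz : 1 < ‖z‖) :
    Summable fun t : ℤ => if t < 0 then ‖z ^ t‖ ^ 2 else 0 := by
  have hr : ‖z‖⁻¹ ^ 2 < 1 := pow_lt_one₀ (by positivity) (inv_lt_one_of_one_lt₀ hz) two_ne_zero
  refine Summable.of_nat_of_neg ?_ ?_
  · simp only [show ∀ k : ℕ, ¬((k : ℤ) < 0) from fun k => by omega, if_false]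
    exact summable_zero
  · refine Summable.of_nonneg_of_le (fun k => by positivity) (fun k => ?_)
      (summable_geometric_of_lt_one (by positivity) hr)
    split_ifs
    · rw [_root_.zpow_neg, zpow_natCast, norm_inv, norm_pow, ← inv_pow, ← pow_mul, ← pow_mul, mul_comm]
    · positivity

/-- The inputs built from `v` and `-I v` are the real and imaginary parts of one complex
exponential, so their energy densities add up to a multiple of `‖v‖²`. -/
theorem pastExponential_dotProduct_self {ι : Type*} [Fintype ι] (z : ℂ) (v : ι → ℂ) (t : ℤ) :
    pastExponential z v t ⬝ᵥ pastExponential z v t +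
      pastExponential z (-Complex.I • v) t ⬝ᵥ pastExponential z (-Complex.I • v) t =
      (if t < 0 then ‖z ^ t‖ ^ 2 else 0) * ∑ i, ‖v i‖ ^ 2 := by
  rw [dotProduct_self_eq_sum_sq, dotProduct_self_eq_sum_sq, ← Finset.sum_add_distrib,
    Finset.mul_sum]
  refine Finset.sum_congr rfl fun i _ => ?_
  unfold pastExponential
  split_ifs
  · rw [Pi.smul_apply, smul_eq_mul, mul_assoc, sq_re_add_sq_re_neg_I_mul, norm_mul, mul_pow,
      mul_comm]
  · simp

theorem isL2_pastExponential {ι : Type*} [Fintype ι] {z : ℂ} (hz : 1 < ‖z‖) (v : ι → ℂ) :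
    IsL2 (pastExponential z v) := by
  refine Summable.of_nonneg_of_le (fun _ => dotProduct_self_nonneg_real _) (fun t => ?_)
    ((summable_norm_zpow_sq_of_neg hz).mul_right (∑ i, ‖v i‖ ^ 2))
  rw [← pastExponential_dotProduct_self]
  exact le_add_of_nonneg_right (dotProduct_self_nonneg_real _)

namespace LTISystem

variable {n m p : Type*} [Fintype n] [DecidableEq n] [Fintype m]

/-- As long as an exponential input has been switched on for the whole past, the output is exactly
the exponential with amplitude `G(z) v`. -/
theorem IsStable.output_pastExponential {G : LTISystem n m p} (hG : G.IsStable) {z : ℂ}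
    (hz : 1 < ‖z‖) (v : m → ℂ) {t : ℤ} (ht : t < 0) :
    G.output (pastExponential z v) t = pastExponential z (G.transfer z *ᵥ v) t := by
  have hz0 : z ≠ 0 := norm_pos_iff.1 (zero_lt_one.trans hz)
  set Y : n → ℂ := (z • (1 : Matrix n n ℂ) - G.A.map (fun a : ℝ => (a : ℂ)))⁻¹ *ᵥ
    (G.B.map (fun a : ℝ => (a : ℂ)) *ᵥ v) with hY
  have hYz : z • Y = G.A.map (fun a : ℝ => (a : ℂ)) *ᵥ Y +
      G.B.map (fun a : ℝ => (a : ℂ)) *ᵥ v := by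
    have h1 : (z • (1 : Matrix n n ℂ) - G.A.map (fun a : ℝ => (a : ℂ))) *ᵥ Y =
        G.B.map (fun a : ℝ => (a : ℂ)) *ᵥ v := by
      rw [hY, Matrix.mulVec_mulVec, mul_nonsing_inv _ (hG.isUnit_det_smul_one_sub hz.le),
        Matrix.one_mulVec]
    rw [← h1, Matrix.sub_mulVec, Matrix.smul_mulVec, Matrix.one_mulVec]
    abel
  have hd : ∀ s < 0, pastExponential z v s = fun i => (v i * z ^ s).re := fun s hs => by
    ext i
    simp [pastExponential, hs]
  -- Freezing the exponent at time `0` keeps the candidate trajectory bounded.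
  have hx : G.state (pastExponential z v) t = fun i => (Y i * z ^ (min t 0)).re := by
    refine IsSchur.forwardSol_eq_of_recursion (q := fun t i => (Y i * z ^ (min t 0)).re) hG
      ((isL2_pastExponential hz v).isBoundedSignal.mulVec G.B) ?_ fun s hs => ?_
    · refine ⟨∑ i, ‖Y i‖, fun s i => (Complex.abs_re_le_norm _).trans ?_⟩
      have h1 : ‖z ^ (min s 0)‖ ≤ 1 := by
        rw [norm_zpow]
        exact zpow_le_one_of_nonpos₀ hz.le (min_le_right _ _)
      rw [norm_mul]
      exact (mul_le_of_le_one_right (norm_nonneg _) h1).trans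
        (Finset.single_le_sum (f := fun i => ‖Y i‖) (fun _ _ => norm_nonneg _)
          (Finset.mem_univ i))
    · rw [hd s (hs.trans ht), min_eq_left (by omega), min_eq_left (by omega), Matrix.mulVec_re,
        Matrix.mulVec_re]
      ext i
      have h1 := congrFun hYz i
      simp only [Pi.smul_apply, Pi.add_apply, smul_eq_mul] at h1
      rw [Pi.add_apply, ← Complex.add_re, ← add_mul, ← h1, zpow_add_one₀ hz0]
      ring_nf
  rw [output_apply, hx, hd t ht, min_eq_left ht.le, Matrix.mulVec_re, Matrix.mulVec_re,
    transfer_mulVec, ← hY]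
  ext i
  simp [pastExponential, ht, add_mul]

variable [Fintype p] [DecidableEq m]

theorem IsStable.sum_norm_sq_transfer_mulVec_le_of_gain {G : LTISystem n m p} (hG : G.IsStable)
    {c : ℝ} (h : ∀ d, IsL2 d → energy (G.output d) ≤ c ^ 2 * energy d) {z : ℂ}
    (hz : 1 < ‖z‖) (v : m → ℂ) :
    ∑ i, ‖(G.transfer z *ᵥ v) i‖ ^ 2 ≤ c ^ 2 * ∑ i, ‖v i‖ ^ 2 := by
  have hd₁ := isL2_pastExponential hz v
  have hd₂ := isL2_pastExponential hz (-Complex.I • v)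
  have hy₁ := hG.isL2_output hd₁
  have hy₂ := hG.isL2_output hd₂
  have hg := summable_norm_zpow_sq_of_neg hz
  set N : ℝ := ∑' t : ℤ, if t < 0 then ‖z ^ t‖ ^ 2 else 0 with hN
  have hz0 : z ≠ 0 := norm_pos_iff.1 (zero_lt_one.trans hz)
  have hN0 : 0 < N := by
    refine hg.tsum_pos (fun t => ?_) (-1) ?_
    · split_ifs <;> positivity
    · rw [if_pos (by norm_num)]
      exact pow_pos (norm_pos_iff.2 (_root_.zpow_ne_zero _ hz0)) 2
  have hin : energy (pastExponential z v) + energy (pastExponential z (-Complex.I • v)) =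
      N * ∑ i, ‖v i‖ ^ 2 := by
    unfold energy
    rw [← hd₁.tsum_add hd₂, hN, ← tsum_mul_right]
    exact tsum_congr fun t => pastExponential_dotProduct_self z v t
  have hout : N * ∑ i, ‖(G.transfer z *ᵥ v) i‖ ^ 2 ≤ energy (G.output (pastExponential z v)) +
      energy (G.output (pastExponential z (-Complex.I • v))) := by
    unfold energy
    rw [← hy₁.tsum_add hy₂, hN, ← tsum_mul_right]
    refine (hg.mul_right _).tsum_le_tsum (fun t => ?_) (hy₁.add hy₂)
    by_cases ht : t < 0
    · rw [hG.output_pastExponential hz v ht, hG.output_pastExponential hz _ ht,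
        Matrix.mulVec_smul, pastExponential_dotProduct_self]
    · rw [if_neg ht, zero_mul]
      exact add_nonneg (dotProduct_self_nonneg_real _) (dotProduct_self_nonneg_real _)
  have h1 : N * ∑ i, ‖(G.transfer z *ᵥ v) i‖ ^ 2 ≤ N * (c ^ 2 * ∑ i, ‖v i‖ ^ 2) := by
    calc _ ≤ _ := hout
      _ ≤ c ^ 2 * energy (pastExponential z v) +
          c ^ 2 * energy (pastExponential z (-Complex.I • v)) := add_le_add (h _ hd₁) (h _ hd₂)
      _ = c ^ 2 * (N * ∑ i, ‖v i‖ ^ 2) := by rw [← mul_add, hin]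
      _ = _ := by ring
  exact le_of_mul_le_mul_left h1 hN0

open scoped Matrix.Norms.L2Operator in
/-- The `H∞` norm of a stable system is its `ℓ₂`-gain. -/
theorem IsStable.hinfNorm_le_iff {G : LTISystem n m p} (hG : G.IsStable) {c : ℝ} (hc : 0 ≤ c) :
    G.hinfNorm ≤ c ↔ ∀ d, IsL2 d → energy (G.output d) ≤ c ^ 2 * energy d := by
  constructor
  · intro h d hd
    refine (hG.energy_output_le hd).trans ?_
    gcongr
    · exact energy_nonneg d
    · exact G.hinfNorm_nonneg
  · intro h
    have hout : ∀ z : ℂ, 1 < ‖z‖ → ‖G.transfer z‖ ≤ c := fun z hz => by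
      rw [Matrix.l2_opNorm_def]
      refine ContinuousLinearMap.opNorm_le_bound _ hc fun v => ?_
      have h1 := hG.sum_norm_sq_transfer_mulVec_le_of_gain h hz v.ofLp
      rw [sum_norm_sq_eq, sum_norm_sq_eq, ← mul_pow] at h1
      exact le_of_sq_le_sq h1 (by positivity)
    have : Nonempty (Set.Icc (0 : ℝ) (2 * Real.pi)) := ⟨⟨0, le_rfl, Real.two_pi_pos.le⟩⟩
    refine ciSup_le fun θ => ?_
    set z := Complex.exp ((θ : ℝ) * Complex.I)
    have hz : ‖z‖ = 1 := Complex.norm_exp_ofReal_mul_I _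
    -- The circle is approached radially from outside.
    have hlim : Tendsto (fun r : ℝ => (r : ℂ) * z) (𝓝[>] 1) (𝓝 z) := by
      have hcont : Continuous fun r : ℝ => (r : ℂ) * z := by fun_prop
      simpa using (hcont.tendsto 1).mono_left nhdsWithin_le_nhds
    refine le_of_tendsto ((hG.continuousAt_transfer hz.ge).tendsto.comp hlim).norm ?_
    filter_upwards [self_mem_nhdsWithin] with r hr
    refine hout _ ?_
    have hr1 : (1 : ℝ) < r := hr
    rw [norm_mul, hz, mul_one, Complex.norm_real, Real.norm_of_nonneg (by linarith)]
    exact hr1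

/-- A strict `H∞` bound is an `ℓ₂`-gain bound with a uniform margin. -/
theorem IsStable.hinfNorm_lt_iff {G : LTISystem n m p} (hG : G.IsStable) {c : ℝ} (hc : 0 < c) :
    G.hinfNorm < c ↔ ∃ ε : ℝ, 0 < ε ∧
      ∀ d, IsL2 d → energy (G.output d) + ε * energy d ≤ c ^ 2 * energy d := by
  constructor
  · intro h
    refine ⟨c ^ 2 - G.hinfNorm ^ 2, sub_pos.2 (pow_lt_pow_left₀ h G.hinfNorm_nonneg two_ne_zero),
      fun d hd => ?_⟩
    linarith [hG.energy_output_le hd]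
  · rintro ⟨ε, hε, h⟩
    -- The margin may exceed `c²` when every input is zero, hence the truncation at zero.
    have h1 : G.hinfNorm ≤ √(max (c ^ 2 - ε) 0) := by
      refine (hG.hinfNorm_le_iff (Real.sqrt_nonneg _)).2 fun d hd => ?_
      rw [Real.sq_sqrt (le_max_right _ _)]
      have h2 := mul_le_mul_of_nonneg_right (le_max_left (c ^ 2 - ε) 0) (energy_nonneg d)
      linarith [h d hd]
    refine h1.trans_lt ((Real.sqrt_lt' hc).2 (max_lt (by linarith) (by positivity)))

end LTISystem

/-! ### Regret as a weighted gain bound -/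

namespace Plant

variable {nx nd nu ne ny nF nK : Type*}
  [Fintype nx] [DecidableEq nx] [Fintype nd] [Fintype nu] [DecidableEq nu] [Fintype ne]
  {P : Plant nx nd nu ne ny} {X : Matrix nx nx ℝ} {γd γJ : ℝ}

theorem achievesRegret_one_right_iff [Fintype ny] [Fintype nK] [DecidableEq nK]
    {K : LTISystem nK ny nu} {γ : ℝ} :
    P.AchievesRegret X γ 1 K ↔ P.AchievesAdditiveRegret X γ K := by
  refine and_congr_right fun _ => exists_congr fun ε => and_congr_right fun _ =>
    forall_congr' fun d => imp_congr_right fun _ => ?_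
  constructor <;> intro h <;> linarith

variable [DecidableEq nd] [Fintype nF] [DecidableEq nF] {F : LTISystem nF nd nd}

theorem IsSpectralFactor.inverse_output (hF : P.IsSpectralFactor X γd γJ F) {d : ℤ → nd → ℝ}
    (hd : IsL2 d) : F.inverse.output (F.output d) = d :=
  LTISystem.output_inverse_output hF.stable hF.invertible hF.inverse_stable hd.isBoundedSignal

theorem IsSpectralFactor.output_inverse (hF : P.IsSpectralFactor X γd γJ F) {d : ℤ → nd → ℝ}
    (hd : IsL2 d) : F.output (F.inverse.output d) = d :=
  LTISystem.output_output_inverse hF.stable hF.invertible hF.inverse_stable hd.isBoundedSignal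

theorem IsSpectralFactor.exists_upper_bound (hF : P.IsSpectralFactor X γd γJ F) :
    ∃ c : ℝ, 0 < c ∧ ∀ d, IsL2 d → energy (F.output d) ≤ c * energy d := by
  refine ⟨F.hinfNorm ^ 2 + 1, by positivity, fun d hd => ?_⟩
  linarith [hF.stable.energy_output_le hd, energy_nonneg d]

/-- The gain of the inverse bounds the benchmark from below. -/
theorem IsSpectralFactor.exists_lower_bound (hF : P.IsSpectralFactor X γd γJ F) :
    ∃ c : ℝ, 0 < c ∧ ∀ d, IsL2 d → energy d ≤ c * energy (F.output d) := by
  refine ⟨F.inverse.hinfNorm ^ 2 + 1, by positivity, fun d hd => ?_⟩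
  have h := hF.inverse_stable.energy_output_le (hF.stable.isL2_output hd)
  rw [hF.inverse_output hd] at h
  linarith [energy_nonneg (F.output d)]

variable [Fintype ny] [Fintype nK] [DecidableEq nK] {K : LTISystem nK ny nu}

theorem IsSpectralFactor.cost_eq (hF : P.IsSpectralFactor X γd γJ F)
    (hK : (P.lowerLFT K).IsStable) {d : ℤ → nd → ℝ} (hd : IsL2 d) :
    P.cost K d = energy (((P.lowerLFT K).series F.inverse).output (F.output d)) := by
  rw [LTISystem.output_series hK hF.inverse_stable (hF.stable.isL2_output hd).isBoundedSignal,
    hF.inverse_output hd]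
  rfl

theorem IsSpectralFactor.energy_series_output (hF : P.IsSpectralFactor X γd γJ F)
    (hK : (P.lowerLFT K).IsStable) {w : ℤ → nd → ℝ} (hw : IsL2 w) :
    energy (((P.lowerLFT K).series F.inverse).output w) = P.cost K (F.inverse.output w) := by
  rw [LTISystem.output_series hK hF.inverse_stable hw.isBoundedSignal]
  rfl

/-- With `w = F d` the benchmark is `‖w‖²` and the cost is the energy of the weighted closed loop
driven by `w`; the margins `ε ‖d‖²` and `ε ‖w‖²` are interchangeable as `F` and its inverse have
finite gain. -/
theorem IsSpectralFactor.achievesRegret_iff (hF : P.IsSpectralFactor X γd γJ F) :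
    P.AchievesRegret X γd γJ K ↔ ((P.lowerLFT K).series F.inverse).IsStable ∧
      ((P.lowerLFT K).series F.inverse).hinfNorm < 1 := by
  constructor
  · rintro ⟨hK, ε, hε, h⟩
    have hS := LTISystem.series_isStable_iff.2 ⟨hK, hF.inverse_stable⟩
    refine ⟨hS, (hS.hinfNorm_lt_iff one_pos).2 ?_⟩
    obtain ⟨c, hc0, hc⟩ := hF.exists_upper_bound
    refine ⟨ε / c, by positivity, fun w hw => ?_⟩
    have hd := hF.inverse_stable.isL2_output hw
    have h1 := h _ hd
    have h2 := hc _ hd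
    rw [hF.energy_eq _ hd] at h1
    rw [hF.output_inverse hw] at h1 h2
    rw [hF.energy_series_output hK hw]
    have h3 : ε / c * energy w ≤ ε * energy (F.inverse.output w) := by
      rw [div_mul_eq_mul_div, div_le_iff₀ hc0]
      nlinarith
    linarith
  · rintro ⟨hS, hn⟩
    have hK := (LTISystem.series_isStable_iff.1 hS).1
    obtain ⟨ε, hε, h⟩ := (hS.hinfNorm_lt_iff one_pos).1 hn
    obtain ⟨c, hc0, hc⟩ := hF.exists_lower_bound
    refine ⟨hK, ε / c, by positivity, fun d hd => ?_⟩
    have h1 := h _ (hF.stable.isL2_output hd)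
    have h3 : ε / c * energy d ≤ ε * energy (F.output d) := by
      rw [div_mul_eq_mul_div, div_le_iff₀ hc0]
      nlinarith [hc d hd]
    rw [hF.energy_eq d hd, hF.cost_eq hK hd]
    linarith

theorem IsSpectralFactor.achievesPointwiseRegret_of_hinfNorm_lt
    (hF : P.IsSpectralFactor X γd γJ F) (hS : ((P.lowerLFT K).series F.inverse).IsStable)
    (hn : ((P.lowerLFT K).series F.inverse).hinfNorm < 1) :
    P.AchievesPointwiseRegret X γd γJ K := by
  obtain ⟨hK, ε, hε, h⟩ := hF.achievesRegret_iff.2 ⟨hS, hn⟩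
  refine ⟨hK, fun d hd hd0 => ?_⟩
  linarith [h d hd, mul_pos hε (energy_pos hd hd0)]

theorem IsSpectralFactor.hinfNorm_le_of_achievesPointwiseRegret
    (hF : P.IsSpectralFactor X γd γJ F) (h : P.AchievesPointwiseRegret X γd γJ K) :
    ((P.lowerLFT K).series F.inverse).IsStable ∧
      ((P.lowerLFT K).series F.inverse).hinfNorm ≤ 1 := by
  obtain ⟨hK, h⟩ := h
  have hS := LTISystem.series_isStable_iff.2 ⟨hK, hF.inverse_stable⟩
  refine ⟨hS, (hS.hinfNorm_le_iff zero_le_one).2 fun w hw => ?_⟩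
  have hd := hF.inverse_stable.isL2_output hw
  rw [one_pow, one_mul, hF.energy_series_output hK hw]
  by_cases hd0 : F.inverse.output w = 0
  · rw [hd0, cost, LTISystem.output_zero, energy_zero]
    exact energy_nonneg w
  · have h1 := h _ hd hd0
    rw [hF.energy_eq _ hd, hF.output_inverse hw] at h1
    exact h1.le

theorem achievesRegret_zero_right_iff {γ : ℝ} (hγ : 0 < γ) :
    P.AchievesRegret X γ 0 K ↔ P.AchievesHinf γ K := by
  refine and_congr_right fun hK => ?_
  rw [hK.hinfNorm_lt_iff hγ]
  simp [cost]

/-- For `γd = 0` the spectral factor makes `γJ² J(Kᵒ, d)` comparable with `‖d‖²`, so that a margin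
in the ratio is the same as a margin in the energy of the disturbance. -/
theorem IsSpectralFactor.achievesRegret_zero_left_iff (hF : P.IsSpectralFactor X 0 γJ F) :
    P.AchievesRegret X 0 γJ K ↔ P.AchievesCompetitiveRatio X γJ K := by
  have hb : ∀ d, IsL2 d → γJ ^ 2 * P.ncCost X d = energy (F.output d) := fun d hd => by
    simpa using hF.energy_eq d hd
  refine and_congr_right fun hK => ?_
  simp only [ne_eq, OfNat.ofNat_ne_zero, not_false_eq_true, zero_pow, zero_mul, zero_add]
  constructor
  · rintro ⟨ε, hε, h⟩
    obtain ⟨c, hc0, hc⟩ := hF.exists_upper_bound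
    -- Since `‖d‖² ≥ γJ² J(Kᵒ, d) / c`, the ratio is at most `γJ² - ε γJ² / c`. For `γJ = 0` there is
    -- no nonzero input, and the subtracted `1` only makes the bound strict.
    refine ⟨γJ ^ 2 - ε * γJ ^ 2 / c - (if γJ = 0 then 1 else 0), ?_, fun d hd hd0 => ?_⟩
    · split_ifs with h0
      · simp [h0]
      · have : 0 < ε * γJ ^ 2 / c := by positivity
        linarith
    · have he := energy_pos hd hd0
      have h1 := h d hd
      have hJ : 0 < γJ ^ 2 * P.ncCost X d :=
        lt_of_lt_of_le (add_pos_of_nonneg_of_pos (energy_nonneg _) (mul_pos hε he)) h1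
      have hγ : γJ ≠ 0 := by
        rintro rfl
        simp at hJ
      have hJ0 : 0 < P.ncCost X d := pos_of_mul_pos_right hJ (sq_nonneg _)
      refine ⟨hJ0, ?_⟩
      rw [if_neg hγ, sub_zero, div_le_iff₀ hJ0]
      have h2 : ε * γJ ^ 2 / c * P.ncCost X d ≤ ε * energy d := by
        rw [div_mul_eq_mul_div, div_le_iff₀ hc0]
        have := hc d hd
        rw [← hb d hd] at this
        nlinarith
      linarith
  · rintro ⟨ρ, hρ, h⟩
    obtain ⟨c, hc0, hc⟩ := hF.exists_lower_bound
    -- The summand `1` keeps the denominator positive if `γJ = 0`.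
    refine ⟨(γJ ^ 2 - ρ) / (c * (γJ ^ 2 + 1)),
      div_pos (sub_pos.2 hρ) (by positivity), fun d hd => ?_⟩
    by_cases hd0 : d = 0
    · rw [hd0, cost, LTISystem.output_zero, energy_zero, energy_zero]
      have : 0 ≤ P.ncCost X 0 := energy_nonneg _
      simpa using mul_nonneg (sq_nonneg γJ) this
    · obtain ⟨hJ, hr⟩ := h d hd hd0
      rw [div_le_iff₀ hJ] at hr
      have h1 : energy d ≤ P.ncCost X d * (c * (γJ ^ 2 + 1)) := by
        have := hc d hd
        rw [← hb d hd] at this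
        nlinarith [mul_pos hc0 hJ]
      have h2 : (γJ ^ 2 - ρ) / (c * (γJ ^ 2 + 1)) * energy d ≤
          (γJ ^ 2 - ρ) * P.ncCost X d := by
        rw [div_mul_eq_mul_div, div_le_iff₀ (by positivity), mul_assoc]
        exact mul_le_mul_of_nonneg_left h1 (sub_pos.2 hρ).le
      linarith

end Plant

theorem mainTheorem3 {nx nd nu ne ny nF : Type*}
    [Fintype nx] [DecidableEq nx] [Fintype nd] [DecidableEq nd] [Fintype nu] [DecidableEq nu]
    [Fintype ne] [DecidableEq ne] [Fintype ny] [DecidableEq ny] [Fintype nF] [DecidableEq nF]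
    (P : Plant nx nd nu ne ny) (hP : P.Regular)
    (X : Matrix nx nx ℝ) (hX : P.IsStabilizingSolution X)
    (γd γJ : ℝ) (hγd : 0 ≤ γd) (hγJ : 0 ≤ γJ)
    (F : LTISystem nF nd nd) (hF : P.IsSpectralFactor X γd γJ F) :
    -- for every controller
    (∀ (nK : ℕ) (K : LTISystem (Fin nK) ny nu),
      -- regret if and only if the weighted closed loop is stable with `H∞` norm below one
      (P.AchievesRegret X γd γJ K ↔
        ((P.lowerLFT K).series F.inverse).IsStable ∧
          ((P.lowerLFT K).series F.inverse).hinfNorm < 1) ∧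
      -- the pointwise strict bound follows from norm below one, and gives norm at most one
      (((P.lowerLFT K).series F.inverse).IsStable ∧
          ((P.lowerLFT K).series F.inverse).hinfNorm < 1 → P.AchievesPointwiseRegret X γd γJ K) ∧
      (P.AchievesPointwiseRegret X γd γJ K →
        ((P.lowerLFT K).series F.inverse).IsStable ∧
          ((P.lowerLFT K).series F.inverse).hinfNorm ≤ 1) ∧
      -- it is the standard `H∞` specification for the weighted plant
      (P.AchievesRegret X γd γJ K ↔ (P.weighted F.inverse).AchievesHinf 1 K) ∧
      -- special cases
      (∀ γ : ℝ, 0 < γ → (P.AchievesRegret X γ 0 K ↔ P.AchievesHinf γ K)) ∧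
      (∀ γ : ℝ, 0 ≤ γ → (P.AchievesRegret X γ 1 K ↔ P.AchievesAdditiveRegret X γ K)) ∧
      (γd = 0 → (P.AchievesRegret X 0 γJ K ↔ P.AchievesCompetitiveRatio X γJ K))) ∧
    -- the regret feasibility problem is an `H∞` feasibility problem
    ((∃ (nK : ℕ) (K : LTISystem (Fin nK) ny nu), P.AchievesRegret X γd γJ K) ↔
      ∃ (nK : ℕ) (K : LTISystem (Fin nK) ny nu), (P.weighted F.inverse).AchievesHinf 1 K) := by
  have hiff : ∀ (nK : ℕ) (K : LTISystem (Fin nK) ny nu),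
      P.AchievesRegret X γd γJ K ↔ (P.weighted F.inverse).AchievesHinf 1 K := fun nK K =>
    hF.achievesRegret_iff.trans (Plant.achievesHinf_weighted_iff P F.inverse K 1).symm
  refine ⟨fun nK K => ⟨hF.achievesRegret_iff,
    fun h => hF.achievesPointwiseRegret_of_hinfNorm_lt h.1 h.2,
    hF.hinfNorm_le_of_achievesPointwiseRegret, hiff nK K,
    fun γ hγ => Plant.achievesRegret_zero_right_iff hγ,
    fun γ _ => Plant.achievesRegret_one_right_iff, ?_⟩,
    exists_congr fun nK => exists_congr fun K => hiff nK K⟩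
  rintro rfl
  exact hF.achievesRegret_zero_left_iff
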